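/- \textbf{Setting.} Let $k\ge 1$, $d\ge \max(2k,3)$, $\epsilon\in(0,1)$, $\sigma>0$, $n\ge 1$. Inputs are $x\sim p=N(0,\Sigma)$ on $\mathbb R^d$ with $\Sigma=\mathrm{diag}(\epsilon I_{d-k},I_k)$; a task $\theta\in\mathbb R^d$ produces samples $(x,y)$ with $y\mid x\sim N(x^\top\theta,\sigma^2)$. Let $E^*$ and $E_k$ be the spans of the first $d-k$ and of the last $k$ coordinate vectors. For $B^*\in\mathbb R^{d\times k}$ with orthonormal columns and $\mathrm{col}(B^*)\subset E^*$, the task distribution of $B^*$ is the law of $$\theta=\tfrac1{\sqrt{2\epsilon}}B^*w+\delta ,$$ with $w$ and $\delta$ independent and uniform on the unit spheres of $\mathbb R^k$ and of $E_k$, and $S_{B^*}$ is the set of all such $\theta$ with $\|w\|_2=1$, $\delta\in E_k$, $\|\delta\|_2=1$. A FrozenRep representation learned from infinite source data (infinitely many tasks and samples per task) for $B^*$ is a minimizer $\hat B$ over $B\in\mathbb R^{d\times k}$ of $$\mathbb E_{\theta}\Big[\min_{w\in\mathbb R^k}\tfrac12\,\mathbb E_{(x,y)}\big(y-x^\top Bw\big)^2\Big],$$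 where $\theta$ follows the task distribution of $B^*$ and $(x,y)$ is a sample of the task $\theta$. The excess risk of a predictor $\hat\theta$ on the task $\theta$ is $\mathbb E_{x\sim p}(x^\top\theta-x^\top\hat\theta)^2$. For a fixed $\hat B$, let $R_n(\hat B)$ be the infimum, over all (possibly randomized) procedures that map $n$ i.i.d. samples of the target task to $(\hat w,\hat\delta)\in\mathbb R^k\times\mathbb R^d$ (and may depend on $\hat B$ and on all parameters of the problem other than $B^*$ and $\theta$), of the supremum, over all $B^*$ as above for which $\hat B$ is a FrozenRep representation and all $\theta\in S_{B^*}$, of the expected excess risk of $\hat B\hat w+\hat\delta$. Let $R_n^{\mathrm{tgt}}$ be the analogous minimax risk of procedures that output any $\hat\theta\in\mathbb R^d$ from the $n$ target samples alone, with the supremum over all $B^*$ as above and all $\theta\in S_{B^*}$. \textbf{Theorem.} There are universal constants $c,C>0$ such that, for all $d,k,n,\epsilon,\sigma$ as above and every $B^*$ as above, a FrozenRep representation for $B^*$ exists, and every FrozenRep representation $\hat B$ for $B^*$ satisfies $$R_n(\hat B)\ \ge\ c\,\min\Big(1,\frac{\sigma^2 d}{n}\Big),\qquad R_n(\hat B)=R_n^{\mathrm{tgt}},\qquad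 R_n^{\mathrm{tgt}}\ \le\ C(1+\sigma^2)\,\frac dn .$$ In particular, for fixed $\sigma$ and $n\ge d$, the minimax excess risk of any procedure that uses $\hat B$ is $\Omega(d/n)$, and this matches the rate $\Theta(d/n)$ of learning from target data alone. -/

import Mathlib

open MeasureTheory ProbabilityTheory
open scoped ENNReal

namespace HardLinear

noncomputable section

/-- Coordinates of `ℝ^d`, split into the first `d - k` and the last `k` ones (used for `k ≤ d`). -/
abbrev Coord (d k : ℕ) : Type := Fin (d - k) ⊕ Fin k

/-- `ℝ^d` with its Euclidean norm. -/
abbrev Vec (d k : ℕ) : Type := EuclideanSpace ℝ (Coord d k)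

/-- `ℝ^k` with its Euclidean norm. -/
abbrev Weight (k : ℕ) : Type := EuclideanSpace ℝ (Fin k)

/-- The matrices in `ℝ^{d × k}`, i.e. the linear representations `x ↦ Bᵀ x`. -/
abbrev Rep (d k : ℕ) : Type := Matrix (Coord d k) (Fin k) ℝ

/-- The vector `B w`. -/
def app {d k : ℕ} (B : Rep d k) (w : Weight k) : Vec d k := Matrix.toEuclideanLin B w

/-- The covariance matrix `Σ = diag(ε I_{d-k}, I_k)`. -/
def covMat (d k : ℕ) (ε : ℝ) : Matrix (Coord d k) (Coord d k) ℝ :=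
  Matrix.fromBlocks (ε • (1 : Matrix (Fin (d - k)) (Fin (d - k)) ℝ)) 0 0 1

/-- The input distribution `p = N(0, Σ)`. -/
def inputDist (d k : ℕ) (ε : ℝ) : Measure (Vec d k) :=
  multivariateGaussian 0 (covMat d k ε)

/-- The law of `(x, y)` with `x ∼ p` and `y | x ∼ N(⟨x, θ⟩, σ²)`. -/
def sampleDist {d k : ℕ} (ε σ : ℝ) (θ : Vec d k) : Measure (Vec d k × ℝ) :=
  ((inputDist d k ε).prod (gaussianReal 0 ⟨σ ^ 2, sq_nonneg σ⟩)).map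
    (fun q => (q.1, inner ℝ q.1 θ + q.2))

/-- A data set of `n` input-label pairs. -/
abbrev Data (d k n : ℕ) : Type := Fin n → Vec d k × ℝ

/-- The law of `n` i.i.d. samples of the task `θ`. -/
def dataDist {d k : ℕ} (ε σ : ℝ) (n : ℕ) (θ : Vec d k) : Measure (Data d k n) :=
  Measure.pi (fun _ => sampleDist ε σ θ)

/-- `E*`, the column span of the first block of `Σ`. -/
def EStar (d k : ℕ) : Set (Vec d k) := {v | ∀ j : Fin k, v (Sum.inr j) = 0}

/-- The isometric embedding of `ℝ^k` onto `E_k`, the column span of the second block of `Σ`. -/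
def embedEk (d k : ℕ) (u : Weight k) : Vec d k :=
  WithLp.toLp 2 (Sum.elim (fun _ => 0) (fun j => u j))

/-- The matrices `B*` with orthonormal columns and `col(B*) ⊂ E*`. -/
def trueReps (d k : ℕ) : Set (Rep d k) :=
  {B | B.transpose * B = 1 ∧ ∀ w : Weight k, app B w ∈ EStar d k}

/-- The uniform probability distribution on the unit sphere of `ℝ^k`, as a measure on `ℝ^k`. -/
def unifSphere (k : ℕ) : Measure (Weight k) :=
  (((volume : Measure (Weight k)).toSphere Set.univ)⁻¹ •
    (volume : Measure (Weight k)).toSphere).map Subtype.val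

/-- The task `θ = B w / √(2ε) + δ`, where `δ ∈ E_k` is given by its coordinates `u`. -/
def task {d k : ℕ} (ε : ℝ) (B : Rep d k) (w u : Weight k) : Vec d k :=
  (1 / Real.sqrt (2 * ε)) • app B w + embedEk d k u

/-- The distribution of `θ = B w / √(2ε) + δ`, where `w` and `δ` are independent and uniform on the
unit spheres of `ℝ^k` and of `E_k`. -/
def taskDist {d k : ℕ} (ε : ℝ) (B : Rep d k) : Measure (Vec d k) :=
  ((unifSphere k).prod (unifSphere k)).map (fun q => task ε B q.1 q.2)

/-- `S_B`, the set of all tasks `B w / √(2ε) + δ` with unit vectors `w ∈ ℝ^k` and `δ ∈ E_k`. -/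
def taskSet {d k : ℕ} (ε : ℝ) (B : Rep d k) : Set (Vec d k) :=
  {θ | ∃ w u : Weight k, ‖w‖ = 1 ∧ ‖u‖ = 1 ∧ θ = task ε B w u}

/-- The population squared loss `½ E (y - ⟨x, v⟩)²` of the linear predictor `v` on the task `θ`. -/
def popLoss {d k : ℕ} (ε σ : ℝ) (θ v : Vec d k) : ℝ :=
  (1 / 2) * ∫ q, (q.2 - inner ℝ q.1 v) ^ 2 ∂(sampleDist ε σ θ)

/-- The frozen-representation source objective with infinitely many tasks drawn from the task
distribution of `Bstar` and infinitely many samples per task: the average over the tasks of the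
least population loss of a predictor `B w`. -/
def frozenObjective {d k : ℕ} (ε σ : ℝ) (Bstar B : Rep d k) : ℝ :=
  ∫ θ, (⨅ w : Weight k, popLoss ε σ θ (app B w)) ∂(taskDist ε Bstar)

/-- `Bhat` is a representation learned by FrozenRep from infinite source data when the ground truth
is `Bstar`: it minimizes the objective over all of `ℝ^{d × k}`. -/
def IsFrozenRep {d k : ℕ} (ε σ : ℝ) (Bstar Bhat : Rep d k) : Prop :=
  ∀ B : Rep d k, frozenObjective ε σ Bstar Bhat ≤ frozenObjective ε σ Bstar B

/-- The excess risk `E_{x ∼ p} (⟨x, θ⟩ - ⟨x, v⟩)²` of the predictor `v` on the task `θ`. -/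
def excessRisk {d k : ℕ} (ε : ℝ) (θ v : Vec d k) : ℝ≥0∞ :=
  ∫⁻ x, ENNReal.ofReal ((inner ℝ x θ - inner ℝ x v) ^ 2) ∂(inputDist d k ε)

/-- The minimax excess risk over procedures that know `Bhat`, see `n` samples of the target task
and output, possibly at random, a pair `(ŵ, δ̂)`, used as the predictor `Bhat ŵ + δ̂`.  The worst case
is over all ground truths `Bstar` for which `Bhat` is a FrozenRep representation, and all
`θ ∈ S_{Bstar}`. -/
def frozenMinimaxRisk {d k : ℕ} (ε σ : ℝ) (n : ℕ) (Bhat : Rep d k) : ℝ≥0∞ :=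
  ⨅ (A : Kernel (Data d k n) (Weight k × Vec d k)) (_ : IsMarkovKernel A),
    ⨆ (Bstar ∈ {B ∈ trueReps d k | IsFrozenRep ε σ B Bhat}) (θ ∈ taskSet ε Bstar),
      ∫⁻ D, ∫⁻ q, excessRisk ε θ (app Bhat q.1 + q.2) ∂(A D) ∂(dataDist ε σ n θ)

/-- The minimax excess risk over procedures that only use `n` samples of the target task, over all
`θ ∈ S_{Bstar}` for all ground truths `Bstar`. -/
def targetMinimaxRisk (d k : ℕ) (ε σ : ℝ) (n : ℕ) : ℝ≥0∞ :=
  ⨅ (A : Kernel (Data d k n) (Vec d k)) (_ : IsMarkovKernel A),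
    ⨆ (Bstar ∈ trueReps d k) (θ ∈ taskSet ε Bstar),
      ∫⁻ D, ∫⁻ v, excessRisk ε θ v ∂(A D) ∂(dataDist ε σ n θ)

end

end HardLinear

/-! The excess risk is the squared Euclidean length of the whitened error `Σ^{1/2}(θ - v)`. In
whitened coordinates a task is `B* w / √2 + δ`, so each of the `k` directions of `E_k` carries twice
the source energy of a column of `B*`. These columns and the basis of `E_k` are `2k` orthonormal
vectors, while the whitened span of a representation has dimension at most `k` and captures at most
`k` of their total energy (`le_residualEnergy_add`). The best use of this budget is to capture all
of `E_k`, which leaves nothing for `B*`. So minimality is equivalent to zero residual energy on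
`E_k` (`isFrozenRep_iff`), a condition that does not mention `B*`.

Consequently `Bhat` reveals nothing about the ground truth: every `B*` is compatible with it. As
`δ̂` is unrestricted, `Bhat ŵ + δ̂` is an arbitrary predictor, and the two minimax risks coincide.

It remains to find the rate of learning from target data. For the lower bound, every unit vector of
`E*` occurs as `B* w` for some `B*` (`exists_trueReps_app_eq`), so the tasks contain a hypercube
with `d - k - 1` free coordinates. Assouad's averaging reduces it to pairs of tasks that differ in
one coordinate, and Le Cam's bound handles a pair (`two_point_risk_lower_bound`). For the upper
bound, the moment estimator `Σ⁻¹ n⁻¹ ∑ x_j y_j` is unbiased, and every task has the same signal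
energy `3/2` (`covForm_task`), so each of the `d` coordinates costs `O((1 + σ²)/n)`. -/

namespace HardLinear

noncomputable section

/-! ### Gaussian input moments and closed forms of the risks -/

/-- The diagonal entries of `Σ`. -/
def eig (d k : ℕ) (ε : ℝ) : Coord d k → ℝ := Sum.elim (fun _ => ε) (fun _ => 1)

/-- The bilinear form `⟨a, Σ b⟩`. -/
def covForm {d k : ℕ} (ε : ℝ) (a b : Vec d k) : ℝ := ∑ i, eig d k ε i * (a i * b i)

lemma covMat_eq_diagonal (d k : ℕ) (ε : ℝ) : covMat d k ε = Matrix.diagonal (eig d k ε) := by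
  rw [covMat, eig, ← Matrix.fromBlocks_diagonal, Matrix.smul_one_eq_diagonal, ← Matrix.diagonal_one]

lemma eig_pos {d k : ℕ} {ε : ℝ} (hε : 0 < ε) (i : Coord d k) : 0 < eig d k ε i := by
  rcases i with i | i <;> simp [eig, hε]

lemma posSemidef_covMat {d k : ℕ} {ε : ℝ} (hε : 0 < ε) : (covMat d k ε).PosSemidef := by
  rw [covMat_eq_diagonal, Matrix.posSemidef_diagonal_iff]
  exact fun i => (eig_pos hε i).le

lemma covForm_self_nonneg {d k : ℕ} {ε : ℝ} (hε : 0 < ε) (a : Vec d k) : 0 ≤ covForm ε a a :=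
  Finset.sum_nonneg fun i _ => mul_nonneg (eig_pos hε i).le (mul_self_nonneg _)

instance {d k : ℕ} {ε : ℝ} : IsGaussian (inputDist d k ε) := by
  unfold inputDist; infer_instance

lemma memLp_inner_inputDist {d k : ℕ} (ε : ℝ) (a : Vec d k) :
    MemLp (fun x => inner ℝ x a) 2 (inputDist d k ε) := by
  have h := IsGaussian.memLp_dual (inputDist d k ε) (innerSL ℝ a) 2 (by simp)
  exact (memLp_congr_ae (Filter.Eventually.of_forall fun x => real_inner_comm _ _)).1 h

lemma integral_inner_inputDist {d k : ℕ} (ε : ℝ) (a : Vec d k) :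
    ∫ x, inner ℝ x a ∂(inputDist d k ε) = 0 := by
  have h : ∫ x, innerSL ℝ a x ∂(inputDist d k ε) = innerSL ℝ a (∫ x, x ∂(inputDist d k ε)) :=
    (innerSL ℝ a).integral_comp_id_comm (IsGaussian.integrable_id (μ := inputDist d k ε))
  have h0 : ∫ x, x ∂(inputDist d k ε) = 0 := integral_id_multivariateGaussian
  rw [h0, map_zero] at h
  rw [← h]
  exact integral_congr_ae (Filter.Eventually.of_forall fun x => real_inner_comm _ _)

lemma integral_inner_mul_inner_inputDist {d k : ℕ} {ε : ℝ} (hε : 0 < ε) (a b : Vec d k) :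
    ∫ x, inner ℝ x a * inner ℝ x b ∂(inputDist d k ε) = covForm ε a b := by
  have hc : ∀ c : Vec d k, (fun x : Vec d k => inner ℝ c x) = fun x => inner ℝ x c :=
    fun c => funext fun x => real_inner_comm _ _
  have h := covarianceBilin_apply_eq_cov
    (IsGaussian.memLp_two_id (μ := inputDist d k ε)) a b
  rw [inputDist, covarianceBilin_multivariateGaussian (posSemidef_covMat hε), ← inputDist,
    hc, hc, covariance_eq_sub (memLp_inner_inputDist ε a) (memLp_inner_inputDist ε b),
    integral_inner_inputDist, zero_mul, sub_zero] at h
  simp only [Pi.mul_apply] at h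
  rw [← h, covForm, covMat_eq_diagonal]
  simp only [dotProduct, Matrix.mulVec_diagonal]
  exact Finset.sum_congr rfl fun i _ => by ring

lemma map_inner_inputDist {d k : ℕ} {ε : ℝ} (hε : 0 < ε) (a : Vec d k) :
    (inputDist d k ε).map (fun x => inner ℝ x a)
      = gaussianReal 0 (covForm ε a a).toNNReal := by
  have h := IsGaussian.map_eq_gaussianReal (μ := inputDist d k ε) (innerSL ℝ a)
  have h1 : ⇑(innerSL ℝ a) = fun x : Vec d k => inner ℝ x a := by
    ext x; simp [real_inner_comm]
  rw [h1, integral_inner_inputDist, variance_of_integral_eq_zero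
    (memLp_inner_inputDist ε a).aemeasurable (integral_inner_inputDist ε a)] at h
  rw [h]
  congr 2
  rw [← integral_inner_mul_inner_inputDist hε]
  simp [sq]

lemma excessRisk_eq {d k : ℕ} {ε : ℝ} (hε : 0 < ε) (θ v : Vec d k) :
    excessRisk ε θ v = ENNReal.ofReal (covForm ε (θ - v) (θ - v)) := by
  rw [excessRisk, ← integral_inner_mul_inner_inputDist hε, ofReal_integral_eq_lintegral_ofReal]
  · simp [inner_sub_right, sq]
  · simpa [sq] using (memLp_inner_inputDist ε (θ - v)).integrable_sq
  · exact Filter.Eventually.of_forall fun x => mul_self_nonneg _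

/-- The variance `σ²` of the noise. -/
def noiseVar (σ : ℝ) : NNReal := ⟨σ ^ 2, sq_nonneg σ⟩

lemma coe_noiseVar (σ : ℝ) : (noiseVar σ : ℝ) = σ ^ 2 := rfl

lemma sampleDist_eq {d k : ℕ} (ε σ : ℝ) (θ : Vec d k) :
    sampleDist ε σ θ = ((inputDist d k ε).prod (gaussianReal 0 (noiseVar σ))).map
      (fun q => (q.1, inner ℝ q.1 θ + q.2)) := rfl

lemma integral_sq_gaussianReal_noiseVar (σ : ℝ) : ∫ y : ℝ, y ^ 2 ∂(gaussianReal 0 (noiseVar σ)) = σ ^ 2 := by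
  rw [← variance_of_integral_eq_zero aemeasurable_id' integral_id_gaussianReal,
    variance_fun_id_gaussianReal, coe_noiseVar]

lemma integral_sq_inner_add_noise {d k : ℕ} {ε : ℝ} (hε : 0 < ε) (σ : ℝ) (a : Vec d k) :
    ∫ q : Vec d k × ℝ, (inner ℝ q.1 a + q.2) ^ 2
      ∂((inputDist d k ε).prod (gaussianReal 0 (noiseVar σ))) = covForm ε a a + σ ^ 2 := by
  set ν := gaussianReal 0 (noiseVar σ) with hνdef
  have hν : MemLp (fun y : ℝ => y) 2 ν := memLp_id_gaussianReal 2
  have h1 := (memLp_inner_inputDist ε a).integrable_sq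
  have h2 := hν.integrable_sq
  have h3 := (memLp_inner_inputDist ε a).integrable (by norm_num)
  have h4 := hν.integrable (by norm_num)
  have : ∀ q : Vec d k × ℝ, (inner ℝ q.1 a + q.2) ^ 2
      = (inner ℝ q.1 a ^ 2 + 2 * (inner ℝ q.1 a * q.2)) + q.2 ^ 2 := fun q => by ring
  simp_rw [this]
  have i1 : Integrable (fun q : Vec d k × ℝ => inner ℝ q.1 a ^ 2) ((inputDist d k ε).prod ν) :=
    h1.comp_fst ν
  have i2 : Integrable (fun q : Vec d k × ℝ => 2 * (inner ℝ q.1 a * q.2))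
      ((inputDist d k ε).prod ν) := (h3.mul_prod h4).const_mul 2
  have i3 : Integrable (fun q : Vec d k × ℝ => q.2 ^ 2) ((inputDist d k ε).prod ν) :=
    h2.comp_snd _
  have i12 : Integrable (fun q : Vec d k × ℝ => inner ℝ q.1 a ^ 2 + 2 * (inner ℝ q.1 a * q.2))
      ((inputDist d k ε).prod ν) := i1.add i2
  rw [integral_add i12 i3, integral_add i1 i2, integral_const_mul,
    integral_prod_mul (fun x => inner ℝ x a) (fun y : ℝ => y), integral_inner_inputDist,
    integral_fun_fst (fun x : Vec d k => inner ℝ x a ^ 2), integral_fun_snd (fun y : ℝ => y ^ 2),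
    integral_sq_gaussianReal_noiseVar,
    ← integral_inner_mul_inner_inputDist hε]
  simp [sq]

lemma popLoss_eq {d k : ℕ} {ε : ℝ} (hε : 0 < ε) (σ : ℝ) (θ v : Vec d k) :
    popLoss ε σ θ v = (1 / 2) * (covForm ε (θ - v) (θ - v) + σ ^ 2) := by
  rw [popLoss, sampleDist_eq, integral_map (by fun_prop) (by fun_prop),
    ← integral_sq_inner_add_noise hε]
  simp only [inner_sub_right]
  congr 1
  refine integral_congr_ae (Filter.Eventually.of_forall fun q => ?_)
  simp only
  ring

/-! ### Le Cam's method and densities of product measures -/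

section LeCam

variable {X Y : Type*} [MeasurableSpace X] [MeasurableSpace Y]

/-- Le Cam's bound: a two-point risk is at least the overlap of the two densities. -/
lemma mul_lintegral_min_le_two_point_risk (ρ : Measure X) {p q : X → ℝ≥0∞} (hp : Measurable p)
    (hq : Measurable q) (A : Kernel X Y) [IsMarkovKernel A] {f g : Y → ℝ≥0∞} (hf : Measurable f)
    (hg : Measurable g) (t : ℝ≥0∞) (ht : ∀ y, t ≤ f y + g y) :
    t * ∫⁻ x, min (p x) (q x) ∂ρ
      ≤ ∫⁻ x, ∫⁻ y, f y ∂(A x) ∂(ρ.withDensity p) + ∫⁻ x, ∫⁻ y, g y ∂(A x) ∂(ρ.withDensity q) := by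
  have mf : Measurable fun x => ∫⁻ y, f y ∂(A x) := hf.lintegral_kernel
  have mg : Measurable fun x => ∫⁻ y, g y ∂(A x) := hg.lintegral_kernel
  rw [lintegral_withDensity_eq_lintegral_mul ρ hp mf, lintegral_withDensity_eq_lintegral_mul ρ hq mg,
    ← lintegral_add_left (hp.mul mf), ← lintegral_const_mul _ (hp.min hq)]
  refine lintegral_mono fun x => ?_
  have h : t ≤ ∫⁻ y, f y ∂(A x) + ∫⁻ y, g y ∂(A x) := by
    rw [← lintegral_add_left hf]
    calc t = ∫⁻ _, t ∂(A x) := by simp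
      _ ≤ _ := lintegral_mono ht
  calc t * min (p x) (q x)
      ≤ (∫⁻ y, f y ∂(A x) + ∫⁻ y, g y ∂(A x)) * min (p x) (q x) := by gcongr
    _ = min (p x) (q x) * ∫⁻ y, f y ∂(A x) + min (p x) (q x) * ∫⁻ y, g y ∂(A x) := by
        rw [add_mul, mul_comm, mul_comm _ (min _ _)]
    _ ≤ _ := by
        simp only [Pi.mul_apply]
        gcongr
        · exact min_le_left _ _
        · exact min_le_right _ _

/-- The overlap of two probability densities is at least half of the squared affinity. -/
lemma sq_lintegral_le_two_mul_lintegral_min (ρ : Measure X) {p q h : X → ℝ≥0∞} (hp : Measurable p)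
    (hq : Measurable q) (hp1 : ∫⁻ x, p x ∂ρ = 1)
    (hq1 : ∫⁻ x, q x ∂ρ = 1) (hpq : ∀ x, h x ^ 2 ≤ p x * q x) :
    (∫⁻ x, h x ∂ρ) ^ 2 ≤ 2 * ∫⁻ x, min (p x) (q x) ∂ρ := by
  have sq_half : ∀ x : ℝ≥0∞, (x ^ (1 / 2 : ℝ)) ^ 2 = x := fun x => by
    rw [← ENNReal.rpow_natCast, ← ENNReal.rpow_mul]; norm_num
  have half_sq : ∀ x : ℝ≥0∞, (x ^ (1 / 2 : ℝ)) ^ (2 : ℝ) = x := fun x => by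
    rw [← ENNReal.rpow_mul]; norm_num
  -- Since `min * max = p * q`, Cauchy–Schwarz bounds the squared affinity by `∫ min * ∫ max`, and
  -- `∫ max ≤ ∫ (p + q) = 2`.
  have hle : ∀ x, h x ≤ min (p x) (q x) ^ (1 / 2 : ℝ) * max (p x) (q x) ^ (1 / 2 : ℝ) := fun x => by
    rw [← ENNReal.mul_rpow_of_nonneg _ _ (by norm_num), min_mul_max]
    calc h x = (h x ^ 2) ^ (1 / 2 : ℝ) := by
          rw [← ENNReal.rpow_natCast, ← ENNReal.rpow_mul]; norm_num
      _ ≤ _ := by gcongr; exact hpq x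
  have hmax : ∫⁻ x, max (p x) (q x) ∂ρ ≤ 2 := by
    calc ∫⁻ x, max (p x) (q x) ∂ρ ≤ ∫⁻ x, p x + q x ∂ρ :=
          lintegral_mono fun x => max_le le_self_add le_add_self
      _ = 2 := by rw [lintegral_add_left hp, hp1, hq1, one_add_one_eq_two]
  calc (∫⁻ x, h x ∂ρ) ^ 2
      ≤ ((∫⁻ x, min (p x) (q x) ∂ρ) ^ (1 / 2 : ℝ) * (∫⁻ x, max (p x) (q x) ∂ρ) ^ (1 / 2 : ℝ)) ^ 2 := by
        gcongr
        refine (lintegral_mono hle).trans ?_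
        have := ENNReal.lintegral_mul_le_Lp_mul_Lq ρ Real.HolderConjugate.two_two
          (f := fun x => min (p x) (q x) ^ (1 / 2 : ℝ)) (g := fun x => max (p x) (q x) ^ (1 / 2 : ℝ))
          ((hp.min hq).pow_const _).aemeasurable ((hp.max hq).pow_const _).aemeasurable
        simpa only [half_sq, Pi.mul_apply] using this
    _ = (∫⁻ x, min (p x) (q x) ∂ρ) * ∫⁻ x, max (p x) (q x) ∂ρ := by
        rw [mul_pow, sq_half, sq_half]
    _ ≤ 2 * ∫⁻ x, min (p x) (q x) ∂ρ := by rw [mul_comm]; gcongr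

/-- It suffices to compare on boxes. There the indicator times the product density is a product of
functions of independent coordinates, so its integral factors. -/
lemma pi_withDensity_eq {n : ℕ} (μ : Measure X) [IsProbabilityMeasure μ] {f : X → ℝ≥0∞}
    (hf : Measurable f) [SigmaFinite (μ.withDensity f)] :
    Measure.pi (fun _ : Fin n => μ.withDensity f)
      = (Measure.pi fun _ : Fin n => μ).withDensity (fun x => ∏ i, f (x i)) := by
  refine Measure.pi_eq fun s hs => ?_
  have hm : ∀ i, Measurable ((s i).indicator f) := fun i => hf.indicator (hs i)
  rw [withDensity_apply _ (MeasurableSet.univ_pi hs),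
    ← lintegral_indicator (MeasurableSet.univ_pi hs)]
  have : ∀ x : Fin n → X, (Set.univ.pi s).indicator (fun x => ∏ i, f (x i)) x
      = ∏ i, (s i).indicator f (x i) := fun x => by
    by_cases hx : x ∈ Set.univ.pi s
    · rw [Set.indicator_of_mem hx]
      exact Finset.prod_congr rfl fun i _ => by rw [Set.indicator_of_mem (hx i trivial)]
    · rw [Set.indicator_of_notMem hx]
      simp only [Set.mem_pi, Set.mem_univ, true_imp_iff, not_forall] at hx
      obtain ⟨i, hi⟩ := hx
      exact (Finset.prod_eq_zero (Finset.mem_univ i) (Set.indicator_of_notMem hi f)).symm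
  simp_rw [this]
  rw [lintegral_prod_eq_prod_lintegral_of_indepFun Finset.univ
    (fun i (x : Fin n → X) => (s i).indicator f (x i))
    (iIndepFun_pi (μ := fun _ : Fin n => μ) fun i => (hm i).aemeasurable)
    (fun i => (hm i).comp (measurable_pi_apply i))]
  refine Finset.prod_congr rfl fun i _ => ?_
  rw [withDensity_apply _ (hs i), ← lintegral_indicator (hs i)]
  exact (measurePreserving_eval (fun _ : Fin n => μ) i).lintegral_comp (hm i)

end LeCam

/-! ### Likelihood ratios of the data and the two-point bound -/

lemma gaussianReal_eq_withDensity (m : ℝ) {v : NNReal} (hv : v ≠ 0) :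
    gaussianReal m v
      = (gaussianReal 0 v).withDensity
          (fun y => ENNReal.ofReal (Real.exp ((m * y - m ^ 2 / 2) / v))) := by
  rw [gaussianReal_of_var_ne_zero m hv, gaussianReal_of_var_ne_zero 0 hv,
    ← withDensity_mul _ (measurable_gaussianPDF 0 v) (by fun_prop)]
  congr 1
  ext y
  have hv' : (v : ℝ) ≠ 0 := by exact_mod_cast hv
  simp only [Pi.mul_apply, gaussianPDF]
  rw [← ENNReal.ofReal_mul (gaussianPDFReal_nonneg _ _ _), gaussianPDFReal, gaussianPDFReal,
    mul_assoc (√_)⁻¹, ← Real.exp_add]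
  congr 3
  field_simp
  ring

instance {d k : ℕ} (ε σ : ℝ) (θ : Vec d k) : IsProbabilityMeasure (sampleDist ε σ θ) := by
  rw [sampleDist_eq]
  exact Measure.isProbabilityMeasure_map (by fun_prop)

instance {d k : ℕ} (ε σ : ℝ) (n : ℕ) (θ : Vec d k) : IsProbabilityMeasure (dataDist ε σ n θ) := by
  unfold dataDist; infer_instance

lemma lintegral_sampleDist {d k : ℕ} (ε σ : ℝ) (θ : Vec d k) {f : Vec d k × ℝ → ℝ≥0∞}
    (hf : Measurable f) :
    ∫⁻ q, f q ∂(sampleDist ε σ θ)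
      = ∫⁻ x, ∫⁻ y, f (x, y) ∂(gaussianReal (inner ℝ x θ) (noiseVar σ)) ∂(inputDist d k ε) := by
  rw [sampleDist_eq, lintegral_map hf (by fun_prop), lintegral_prod _ (by fun_prop)]
  refine lintegral_congr fun x => ?_
  have h := gaussianReal_map_const_add (μ := 0) (v := noiseVar σ) (inner ℝ x θ)
  rw [zero_add] at h
  rw [← h, lintegral_map (by fun_prop) (by fun_prop)]

lemma map_fst_sampleDist {d k : ℕ} (ε σ : ℝ) (θ : Vec d k) :
    (sampleDist ε σ θ).map Prod.fst = inputDist d k ε := by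
  rw [sampleDist_eq, Measure.map_map (by fun_prop) (by fun_prop)]
  exact Measure.fst_prod

/-- The likelihood ratio of one sample of the task `θ` with respect to pure noise. -/
def sampleRatio {d k : ℕ} (σ : ℝ) (θ : Vec d k) (q : Vec d k × ℝ) : ℝ :=
  Real.exp ((inner ℝ q.1 θ * q.2 - inner ℝ q.1 θ ^ 2 / 2) / σ ^ 2)

lemma measurable_sampleRatio {d k : ℕ} (σ : ℝ) (θ : Vec d k) : Measurable (sampleRatio σ θ) := by
  unfold sampleRatio; fun_prop

/-- The law of the input does not depend on the task, so only the conditional Gaussian law of the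
label contributes to the ratio. -/
lemma sampleDist_eq_withDensity {d k : ℕ} (ε : ℝ) {σ : ℝ} (hσ : 0 < σ) (θ : Vec d k) :
    sampleDist ε σ θ
      = (sampleDist ε σ 0).withDensity (fun q => ENNReal.ofReal (sampleRatio σ θ q)) := by
  have hv : noiseVar σ ≠ 0 := by
    rw [Ne, ← NNReal.coe_eq_zero, coe_noiseVar]; positivity
  have hm := (measurable_sampleRatio σ θ).ennreal_ofReal
  refine Measure.ext_of_lintegral _ fun f hf => ?_
  rw [lintegral_withDensity_eq_lintegral_mul _ hm hf, lintegral_sampleDist ε σ θ hf,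
    lintegral_sampleDist ε σ 0 (hm.mul hf)]
  refine lintegral_congr fun x => ?_
  rw [gaussianReal_eq_withDensity _ hv, lintegral_withDensity_eq_lintegral_mul _ (by fun_prop)
    (by fun_prop)]
  simp only [inner_zero_right]
  rfl

/-- The likelihood ratio of the data of the task `θ` with respect to pure noise. -/
def dataRatio {d k : ℕ} (σ : ℝ) {n : ℕ} (θ : Vec d k) (D : Data d k n) : ℝ≥0∞ :=
  ∏ j, ENNReal.ofReal (sampleRatio σ θ (D j))

lemma measurable_dataRatio {d k n : ℕ} (σ : ℝ) (θ : Vec d k) :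
    Measurable (dataRatio σ (n := n) θ) := by
  have := measurable_sampleRatio σ θ
  unfold dataRatio
  fun_prop

lemma dataDist_eq_withDensity {d k : ℕ} (ε : ℝ) {σ : ℝ} (hσ : 0 < σ) (n : ℕ) (θ : Vec d k) :
    dataDist ε σ n θ = (dataDist ε σ n 0).withDensity (dataRatio σ θ) := by
  have h := sampleDist_eq_withDensity ε hσ θ
  have : SigmaFinite ((sampleDist ε σ (0 : Vec d k)).withDensity
      (fun q => ENNReal.ofReal (sampleRatio σ θ q))) := by rw [← h]; infer_instance
  rw [dataDist, h, pi_withDensity_eq _ (measurable_sampleRatio σ θ).ennreal_ofReal]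
  rfl

lemma lintegral_dataRatio {d k : ℕ} (ε : ℝ) {σ : ℝ} (hσ : 0 < σ) (n : ℕ) (θ : Vec d k) :
    ∫⁻ D, dataRatio σ θ D ∂(dataDist ε σ n 0) = 1 := by
  rw [← setLIntegral_univ, ← withDensity_apply _ MeasurableSet.univ, ← dataDist_eq_withDensity ε hσ,
    measure_univ]

/-- The normalized squared distance of two predictors on the inputs of a data set. -/
def designDist {d k n : ℕ} (σ : ℝ) (a b : Vec d k) (D : Data d k n) : ℝ :=
  ∑ j, (inner ℝ (D j).1 a - inner ℝ (D j).1 b) ^ 2 / (8 * σ ^ 2)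

/-- The geometric mean of two Gaussian likelihoods with means `s`, `t` is the likelihood at the
midpoint times `exp(-(s - t)² / (8σ²))`. The affinity of two tasks thus becomes an expectation under
the midpoint task. -/
lemma sq_dataRatio_midpoint_mul_le {d k n : ℕ} {σ : ℝ} (hσ : 0 < σ) (a b : Vec d k)
    (D : Data d k n) :
    (dataRatio σ ((1 / 2 : ℝ) • (a + b)) D * ENNReal.ofReal (Real.exp (-designDist σ a b D))) ^ 2
      = dataRatio σ a D * dataRatio σ b D := by
  simp only [dataRatio, designDist, ← Finset.sum_neg_distrib, Real.exp_sum]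
  rw [ENNReal.ofReal_prod_of_nonneg fun _ _ => (Real.exp_pos _).le, ← Finset.prod_mul_distrib,
    ← Finset.prod_mul_distrib, ← Finset.prod_pow]
  refine Finset.prod_congr rfl fun j _ => ?_
  simp only [sampleRatio, inner_smul_right, inner_add_right]
  rw [← ENNReal.ofReal_mul (Real.exp_pos _).le, ← ENNReal.ofReal_mul (Real.exp_pos _).le,
    ← ENNReal.ofReal_pow (by positivity), ← Real.exp_add, ← Real.exp_add, ← Real.exp_nat_mul]
  congr 2
  have : σ ≠ 0 := hσ.ne'
  field_simp
  push_cast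
  ring

lemma lintegral_designDist {d k : ℕ} {ε σ : ℝ} (hε : 0 < ε) (n : ℕ) (a b θ : Vec d k) :
    ∫⁻ D, ENNReal.ofReal (designDist σ a b D) ∂(dataDist ε σ n θ)
      = ENNReal.ofReal (n * covForm ε (a - b) (a - b) / (8 * σ ^ 2)) := by
  have h8 : 0 ≤ (8 * σ ^ 2)⁻¹ := by positivity
  have hterm : ∀ j : Fin n, ∫⁻ D : Data d k n,
      ENNReal.ofReal ((inner ℝ (D j).1 a - inner ℝ (D j).1 b) ^ 2 / (8 * σ ^ 2)) ∂(dataDist ε σ n θ)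
      = ENNReal.ofReal (covForm ε (a - b) (a - b) / (8 * σ ^ 2)) := fun j => by
    have hf : Measurable fun x : Vec d k =>
        ENNReal.ofReal ((inner ℝ x a - inner ℝ x b) ^ 2 / (8 * σ ^ 2)) := by fun_prop
    have e1 := (measurePreserving_eval (fun _ : Fin n => sampleDist ε σ θ) j).lintegral_comp
      (hf.comp measurable_fst)
    have e2 := lintegral_map (μ := sampleDist ε σ θ) hf measurable_fst
    rw [map_fst_sampleDist] at e2
    refine e1.trans (e2.symm.trans ?_)
    simp only [div_eq_mul_inv, ENNReal.ofReal_mul' h8]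
    rw [lintegral_mul_const _ (by fun_prop)]
    exact congrArg (· * _) (excessRisk_eq hε a b)
  simp only [designDist]
  simp_rw [ENNReal.ofReal_sum_of_nonneg fun j (_ : j ∈ Finset.univ) =>
    div_nonneg (sq_nonneg _) (by positivity : 0 ≤ 8 * σ ^ 2)]
  rw [lintegral_finsetSum _ fun j _ => by fun_prop]
  simp_rw [hterm]
  rw [Finset.sum_const, Finset.card_univ, Fintype.card_fin, nsmul_eq_mul, mul_div_assoc,
    ENNReal.ofReal_mul (Nat.cast_nonneg n), ENNReal.ofReal_natCast]

/-- This is `exp(-x) ≥ 1 - x` integrated over the data, written additively because subtraction in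
`ℝ≥0∞` is truncated. -/
lemma one_le_affinity_add {d k : ℕ} {ε σ : ℝ} (hε : 0 < ε) (n : ℕ)
    (a b θ : Vec d k) :
    1 ≤ ∫⁻ D, ENNReal.ofReal (Real.exp (-designDist σ a b D)) ∂(dataDist ε σ n θ)
      + ENNReal.ofReal (n * covForm ε (a - b) (a - b) / (8 * σ ^ 2)) := by
  have hm : Measurable fun D : Data d k n => designDist σ a b D := by unfold designDist; fun_prop
  rw [← lintegral_designDist (σ := σ) hε n a b θ, ← lintegral_add_left (by fun_prop)]
  calc (1 : ℝ≥0∞) = ∫⁻ _, 1 ∂(dataDist ε σ n θ) := by simp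
    _ ≤ _ := lintegral_mono fun D => by
      have h0 : 0 ≤ designDist σ a b D := Finset.sum_nonneg fun j _ => by positivity
      rw [← ENNReal.ofReal_add (Real.exp_pos _).le h0, ← ENNReal.ofReal_one]
      refine ENNReal.ofReal_le_ofReal ?_
      linarith [Real.add_one_le_exp (-designDist σ a b D)]

/-- The closeness hypothesis makes the mean of `designDist` at most `1/4`. So the affinity is at
least `3/4` and the overlap at least `(3/4)² / 2 = 9/32`. -/
lemma two_point_risk_lower_bound {d k n : ℕ} {ε σ : ℝ} (hε : 0 < ε) (hσ : 0 < σ) (a b : Vec d k)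
    (hab : n * covForm ε (a - b) (a - b) ≤ 2 * σ ^ 2)
    (A : Kernel (Data d k n) (Vec d k)) [IsMarkovKernel A] {f g : Vec d k → ℝ≥0∞}
    (hf : Measurable f) (hg : Measurable g) {t : ℝ} (ht0 : 0 ≤ t)
    (ht : ∀ v, ENNReal.ofReal t ≤ f v + g v) :
    ENNReal.ofReal (9 / 32 * t)
      ≤ ∫⁻ D, ∫⁻ v, f v ∂(A D) ∂(dataDist ε σ n a) + ∫⁻ D, ∫⁻ v, g v ∂(A D) ∂(dataDist ε σ n b) := by
  have hma := measurable_dataRatio (n := n) σ a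
  have hmb := measurable_dataRatio (n := n) σ b
  have h1 := mul_lintegral_min_le_two_point_risk (dataDist ε σ n 0) hma hmb A hf hg _ ht
  rw [← dataDist_eq_withDensity ε hσ, ← dataDist_eq_withDensity ε hσ] at h1
  refine le_trans ?_ h1
  have h2 := sq_lintegral_le_two_mul_lintegral_min (dataDist ε σ n 0) hma hmb
    (lintegral_dataRatio ε hσ n a) (lintegral_dataRatio ε hσ n b)
    (fun D => (sq_dataRatio_midpoint_mul_le hσ a b D).le)
  have hm : Measurable fun D : Data d k n => designDist σ a b D := by unfold designDist; fun_prop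
  have h3 := one_le_affinity_add (σ := σ) hε n a b ((1 / 2 : ℝ) • (a + b))
  rw [dataDist_eq_withDensity ε hσ n ((1 / 2 : ℝ) • (a + b)),
    lintegral_withDensity_eq_lintegral_mul _ (measurable_dataRatio _ _) (by fun_prop)] at h3
  simp only [Pi.mul_apply] at h3
  set I := ∫⁻ D : Data d k n, dataRatio σ ((1 / 2 : ℝ) • (a + b)) D
    * ENNReal.ofReal (Real.exp (-designDist σ a b D)) ∂(dataDist ε σ n 0)
  set m := ∫⁻ D : Data d k n, min (dataRatio σ a D) (dataRatio σ b D) ∂(dataDist ε σ n 0)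
  have h4 : ENNReal.ofReal (n * covForm ε (a - b) (a - b) / (8 * σ ^ 2)) ≤ ENNReal.ofReal (1 / 4) := by
    refine ENNReal.ofReal_le_ofReal ?_
    rw [div_le_iff₀ (by positivity)]
    linarith
  have h5 : ENNReal.ofReal (3 / 4) ≤ I := by
    have h6 : 1 ≤ I + ENNReal.ofReal (1 / 4) := h3.trans (by gcongr)
    rw [← ENNReal.add_le_add_iff_right (a := ENNReal.ofReal (1 / 4)) (by simp),
      ← ENNReal.ofReal_add (by norm_num) (by norm_num)]
    norm_num at h6 ⊢
    exact h6
  have h7 : ENNReal.ofReal (9 / 16) ≤ 2 * m := by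
    refine le_trans ?_ h2
    calc ENNReal.ofReal (9 / 16) = ENNReal.ofReal (3 / 4) ^ 2 := by
          rw [← ENNReal.ofReal_pow (by norm_num)]; norm_num
      _ ≤ _ := by gcongr
  have h8 : ENNReal.ofReal (9 / 32) ≤ m := by
    rw [← ENNReal.mul_le_mul_iff_right (a := 2) (by norm_num) (by norm_num)]
    refine le_trans (le_of_eq ?_) h7
    rw [← ENNReal.ofReal_ofNat, ← ENNReal.ofReal_mul (by norm_num)]
    norm_num
  rw [mul_comm, ENNReal.ofReal_mul ht0]
  gcongr

/-! ### Hypercube of tasks and the minimax lower bound -/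

/-- Assouad's averaging argument over the hypercube. -/
lemma card_mul_le_two_mul_of_cube {ι : Type*} [Fintype ι] [DecidableEq ι] (T : Finset ι)
    (r : ι → (ι → Bool) → ℝ≥0∞) (S β : ℝ≥0∞) (hS : ∀ v, ∑ i ∈ T, r i v ≤ S)
    (hβ : ∀ i ∈ T, ∀ v, β ≤ r i v + r i (Function.update v i (!v i))) :
    T.card * β ≤ 2 * S := by
  -- Flipping one bit permutes the vertices, so both ends of an edge have the same total over the
  -- cube. This is the source of the factor 2.
  have hflip : ∀ i, ∑ v, r i (Function.update v i (!v i)) = ∑ v, r i v := fun i =>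
    (Function.Involutive.bijective (f := fun v : ι → Bool => Function.update v i (!v i))
      fun v => by simp).sum_comp (r i)
  have hN0 : ((Fintype.card (ι → Bool) : ℕ) : ℝ≥0∞) ≠ 0 := by
    exact_mod_cast Fintype.card_ne_zero
  rw [← ENNReal.mul_le_mul_iff_right hN0 (ENNReal.natCast_ne_top _)]
  calc (Fintype.card (ι → Bool) : ℝ≥0∞) * (T.card * β)
      = ∑ i ∈ T, ∑ _v : ι → Bool, β := by
        simp only [Finset.sum_const, Finset.card_univ, nsmul_eq_mul]
        ring
    _ ≤ ∑ i ∈ T, ∑ v : ι → Bool, (r i v + r i (Function.update v i (!v i))) :=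
        Finset.sum_le_sum fun i hi => Finset.sum_le_sum fun v _ => hβ i hi v
    _ = 2 * ∑ v : ι → Bool, ∑ i ∈ T, r i v := by
        simp_rw [Finset.sum_add_distrib, hflip]
        rw [Finset.sum_comm (s := T), two_mul]
    _ ≤ 2 * ∑ _v : ι → Bool, S := by gcongr with v; exact hS v
    _ = _ := by
        simp only [Finset.sum_const, Finset.card_univ, nsmul_eq_mul]
        ring

lemma norm_app {d k : ℕ} {B : Rep d k} (hB : B.transpose * B = 1) (w : Weight k) :
    ‖app B w‖ = ‖w‖ := by
  rw [← sq_eq_sq₀ (norm_nonneg _) (norm_nonneg _), ← real_inner_self_eq_norm_sq,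
    ← real_inner_self_eq_norm_sq]
  simp only [app, EuclideanSpace.inner_eq_star_dotProduct, star_trivial,
    Matrix.ofLp_toLpLin, Matrix.toLin'_apply]
  rw [Matrix.dotProduct_mulVec, ← Matrix.mulVec_transpose, Matrix.mulVec_mulVec, hB,
    Matrix.one_mulVec]

lemma transpose_mul_self_of_norm_app {d k : ℕ} {B : Rep d k} (h : ∀ w, ‖app B w‖ = ‖w‖) :
    B.transpose * B = 1 := by
  let L : Weight k →ₗᵢ[ℝ] Vec d k := ⟨Matrix.toEuclideanLin B, h⟩
  ext i j
  have := L.inner_map_map (EuclideanSpace.single i 1) (EuclideanSpace.single j 1)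
  change inner ℝ (app B (EuclideanSpace.single i 1)) (app B (EuclideanSpace.single j 1)) = _ at this
  rw [EuclideanSpace.inner_eq_star_dotProduct] at this
  simp only [app, Matrix.ofLp_toLpLin, Matrix.toLin'_apply, PiLp.ofLp_single,
    Matrix.mulVec_single_one, star_trivial, EuclideanSpace.inner_single_left, map_one, one_mul,
    Pi.single_apply] at this
  rw [Matrix.mul_apply, Matrix.one_apply, ← this]
  exact Finset.sum_congr rfl fun _ _ => mul_comm _ _

/-- Every unit vector of `E*` is a column combination of some matrix in `trueReps`. -/
lemma exists_trueReps_app_eq {d k : ℕ} {B₀ : Rep d k} (hB₀ : B₀ ∈ trueReps d k) {w : Weight k}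
    (hw : ‖w‖ = 1) {z : Vec d k} (hz : z ∈ EStar d k) (hz1 : ‖z‖ = 1) :
    ∃ B ∈ trueReps d k, app B w = z := by
  set b := app B₀ w
  have hb : ‖b‖ = ‖z‖ := by rw [norm_app hB₀.1, hw, hz1]
  -- A reflection exchanges the equally long vectors `b` and `z`. It moves vectors only along `b -
  -- z`, which lies in `E*`, so composing with it keeps the columns orthonormal and inside `E*`.
  set R := (Submodule.span ℝ {b - z})ᗮ.reflection
  have hR : R b = z := Submodule.reflection_sub hb
  let B : Rep d k := Matrix.toEuclideanLin.symm
    (R.toLinearEquiv.toLinearMap ∘ₗ Matrix.toEuclideanLin B₀)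
  have hB : ∀ u, app B u = R (app B₀ u) := fun u => by simp [app, B]
  refine ⟨B, ⟨transpose_mul_self_of_norm_app fun u => ?_, fun u j => ?_⟩, by rw [hB, hR]⟩
  · rw [hB, LinearIsometryEquiv.norm_map, norm_app hB₀.1]
  · obtain ⟨c, hc⟩ := Submodule.mem_span_singleton.1
      (Submodule.starProjection_apply_mem (Submodule.span ℝ {b - z}) (app B₀ u))
    rw [hB, Submodule.reflection_orthogonal_apply, Submodule.reflection_apply, ← hc]
    have h1 := hB₀.2 u j
    have h2 : b (Sum.inr j) = 0 := hB₀.2 w j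
    have h3 := hz j
    simp [h1, h2, h3]

lemma exists_taskSet_of_mem_EStar {d k : ℕ} {B₀ : Rep d k} (hB₀ : B₀ ∈ trueReps d k) (ε : ℝ)
    {u : Weight k} (hu : ‖u‖ = 1) {z : Vec d k} (hz : z ∈ EStar d k) (hz1 : ‖z‖ = 1) :
    ∃ B ∈ trueReps d k, (1 / Real.sqrt (2 * ε)) • z + embedEk d k u ∈ taskSet ε B := by
  obtain ⟨B, hB, h⟩ := exists_trueReps_app_eq hB₀ hu hz hz1
  exact ⟨B, hB, u, u, hu, hu, by rw [task, h]⟩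

/-- The unit vectors of `E*` indexed by the hypercube. -/
def cubeVec {d k : ℕ} (i₀ : Fin (d - k)) (τ : ℝ) (v : Fin (d - k) → Bool) : Vec d k :=
  WithLp.toLp 2 (Sum.elim
    (fun i => if i = i₀ then √(1 - ((Finset.univ.erase i₀).card : ℝ) * τ ^ 2)
      else if v i then τ else -τ) (fun _ => 0))

lemma cubeVec_inl_of_ne {d k : ℕ} {i₀ i : Fin (d - k)} (τ : ℝ) (v : Fin (d - k) → Bool)
    (h : i ≠ i₀) : cubeVec i₀ τ v (Sum.inl i) = if v i then τ else -τ := by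
  simp [cubeVec, h]

/-- The coordinate `i₀` absorbs the length left over by the others. The hypothesis says that this
leftover is nonnegative. -/
lemma norm_cubeVec {d k : ℕ} (i₀ : Fin (d - k)) {τ : ℝ}
    (hτ : ((Finset.univ.erase i₀).card : ℝ) * τ ^ 2 ≤ 1) (v : Fin (d - k) → Bool) :
    ‖cubeVec i₀ τ v‖ = 1 := by
  rw [← sq_eq_sq₀ (norm_nonneg _) zero_le_one, EuclideanSpace.real_norm_sq_eq,
    Fintype.sum_sum_type, ← Finset.add_sum_erase _ _ (Finset.mem_univ i₀)]
  have h : ∀ i ∈ Finset.univ.erase i₀, cubeVec i₀ τ v (Sum.inl i) ^ 2 = τ ^ 2 := fun i hi => by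
    rw [cubeVec_inl_of_ne _ _ (Finset.ne_of_mem_erase hi)]
    split_ifs <;> ring
  rw [Finset.sum_congr rfl h]
  simp only [cubeVec, Sum.elim_inl, Sum.elim_inr, if_true]
  rw [Real.sq_sqrt (by linarith)]
  simp

lemma cubeVec_mem_EStar {d k : ℕ} (i₀ : Fin (d - k)) (τ : ℝ) (v : Fin (d - k) → Bool) :
    cubeVec i₀ τ v ∈ EStar d k := fun j => by simp [cubeVec]

lemma covForm_eq_single {d k : ℕ} (ε : ℝ) (a : Vec d k) (i : Coord d k)
    (h : ∀ j, j ≠ i → a j = 0) : covForm ε a a = eig d k ε i * (a i * a i) :=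
  Fintype.sum_eq_single i fun j hj => by rw [h j hj]; ring

/-- Coordinates of a task away from a fixed one carry the excess risk separately. -/
lemma sum_ofReal_le_excessRisk {d k : ℕ} {ε : ℝ} (hε : 0 < ε) (T : Finset (Fin (d - k)))
    (θ v : Vec d k) :
    ∑ i ∈ T, ENNReal.ofReal (ε * (θ (Sum.inl i) - v (Sum.inl i)) ^ 2) ≤ excessRisk ε θ v := by
  rw [excessRisk_eq hε, ← ENNReal.ofReal_sum_of_nonneg fun i _ => by positivity]
  refine ENNReal.ofReal_le_ofReal ?_
  rw [covForm, Fintype.sum_sum_type]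
  have h1 : ∑ i ∈ T, ε * (θ (Sum.inl i) - v (Sum.inl i)) ^ 2
      ≤ ∑ i : Fin (d - k), ε * (θ (Sum.inl i) - v (Sum.inl i)) ^ 2 :=
    Finset.sum_le_sum_of_subset_of_nonneg (Finset.subset_univ _) fun i _ _ => by positivity
  have h2 : 0 ≤ ∑ j : Fin k, (θ (Sum.inr j) - v (Sum.inr j)) ^ 2 :=
    Finset.sum_nonneg fun _ _ => sq_nonneg _
  simp only [eig, Sum.elim_inl, Sum.elim_inr, PiLp.sub_apply, ← sq, one_mul]
  linarith

/-- A bit flip changes its coordinate by `2τ / √(2ε)`, hence the whitened task by squared length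
`2τ²`: the scaling of the tasks cancels `ε`. With `n τ² ≤ σ²` the two tasks are hard to tell apart,
and each edge of the cube costs `9/32 τ²`; Assouad's factor 2 turns this into `9/64`. -/
lemma cube_lower_bound {d k n : ℕ} {ε σ τ : ℝ} (hk : 1 ≤ k) (hε : 0 < ε) (hσ : 0 < σ)
    (i₀ : Fin (d - k)) (hτ1 : ((Finset.univ.erase i₀).card : ℝ) * τ ^ 2 ≤ 1)
    (hτ2 : n * τ ^ 2 ≤ σ ^ 2) {B₀ : Rep d k} (hB₀ : B₀ ∈ trueReps d k) :
    ENNReal.ofReal (9 / 64 * (((Finset.univ.erase i₀).card : ℝ) * τ ^ 2))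
      ≤ targetMinimaxRisk d k ε σ n := by
  refine le_iInf₂ fun A hA => ?_
  set S := ⨆ (Bstar ∈ trueReps d k) (θ ∈ taskSet ε Bstar),
      ∫⁻ D, ∫⁻ v, excessRisk ε θ v ∂(A D) ∂(dataDist ε σ n θ)
  let u : Weight k := EuclideanSpace.single ⟨0, hk⟩ 1
  have hu : ‖u‖ = 1 := by simp [u]
  let θ : (Fin (d - k) → Bool) → Vec d k := fun s =>
    (1 / Real.sqrt (2 * ε)) • cubeVec i₀ τ s + embedEk d k u
  have hsq : (Real.sqrt (2 * ε)) ^ 2 = 2 * ε := Real.sq_sqrt (by positivity)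
  have hsq0 : Real.sqrt (2 * ε) ≠ 0 := by positivity
  have hθi : ∀ s i, i ≠ i₀ → θ s (Sum.inl i)
      = (1 / Real.sqrt (2 * ε)) * if s i then τ else -τ := fun s i hi => by
    simp [θ, cubeVec_inl_of_ne _ _ hi, embedEk]
  have hrisk : ∀ s, ∫⁻ D, ∫⁻ v, excessRisk ε (θ s) v ∂(A D) ∂(dataDist ε σ n (θ s)) ≤ S := fun s => by
    obtain ⟨B, hB, hBθ⟩ := exists_taskSet_of_mem_EStar hB₀ ε hu (cubeVec_mem_EStar i₀ τ s)
      (norm_cubeVec i₀ hτ1 s)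
    exact le_iSup₂_of_le B hB (le_iSup₂_of_le (θ s) hBθ le_rfl)
  have hmeas : ∀ c i, Measurable fun v : Vec d k =>
      ENNReal.ofReal (ε * (c - v (Sum.inl i)) ^ 2) := fun c i => by fun_prop
  have key := card_mul_le_two_mul_of_cube (Finset.univ.erase i₀)
    (fun i s => ∫⁻ D, ∫⁻ v, ENNReal.ofReal (ε * (θ s (Sum.inl i) - v (Sum.inl i)) ^ 2)
      ∂(A D) ∂(dataDist ε σ n (θ s))) S (ENNReal.ofReal (9 / 32 * τ ^ 2)) (fun s => ?_)
    fun i hi s => ?_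
  · rw [← ENNReal.mul_le_mul_iff_right (a := 2) (by norm_num) (by norm_num)]
    refine le_trans (le_of_eq ?_) key
    rw [← ENNReal.ofReal_ofNat, ← ENNReal.ofReal_mul (by norm_num), ← ENNReal.ofReal_natCast,
      ← ENNReal.ofReal_mul (Nat.cast_nonneg _)]
    congr 1
    ring
  · refine le_trans ?_ (hrisk s)
    rw [← lintegral_finsetSum _ fun i _ => (hmeas _ i).lintegral_kernel]
    refine lintegral_mono fun D => ?_
    rw [← lintegral_finsetSum _ fun i _ => hmeas _ i]
    exact lintegral_mono fun v => sum_ofReal_le_excessRisk hε _ (θ s) v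
  · have hi' : i ≠ i₀ := Finset.ne_of_mem_erase hi
    set s' := Function.update s i (!s i)
    have hdiff : (θ s (Sum.inl i) - θ s' (Sum.inl i)) ^ 2 = 2 * τ ^ 2 / ε := by
      rw [hθi s i hi', hθi s' i hi', ← mul_sub, mul_pow, div_pow, hsq]
      have : ((if s i then τ else -τ) - if s' i then τ else -τ) ^ 2 = 4 * τ ^ 2 := by
        simp only [s', Function.update_self]
        cases s i <;> simp <;> ring
      rw [this]
      field_simp
      ring
    refine two_point_risk_lower_bound hε hσ (θ s) (θ s') ?_ A (hmeas _ i) (hmeas _ i)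
      (sq_nonneg τ) fun v => ?_
    · have hz : ∀ j, j ≠ Sum.inl i → (θ s - θ s') j = 0 := fun j hj => by
        rcases j with j | j
        · have hji : j ≠ i := fun h => hj (by rw [h])
          simp [θ, s', cubeVec, Function.update_of_ne hji]
        · simp [θ, s', cubeVec]
      rw [covForm_eq_single ε _ _ hz, PiLp.sub_apply, ← sq, hdiff]
      simp only [eig, Sum.elim_inl]
      field_simp
      linarith
    · rw [← ENNReal.ofReal_add (by positivity) (by positivity)]
      refine ENNReal.ofReal_le_ofReal ?_
      -- No `v` is close to both tasks: the two squared errors add up to at least half of the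
      -- squared gap.
      have h1 : (θ s (Sum.inl i) - θ s' (Sum.inl i)) ^ 2
          ≤ 2 * ((θ s (Sum.inl i) - v (Sum.inl i)) ^ 2 + (θ s' (Sum.inl i) - v (Sum.inl i)) ^ 2) := by
        nlinarith [sq_nonneg (θ s (Sum.inl i) + θ s' (Sum.inl i) - 2 * v (Sum.inl i))]
      rw [hdiff, div_le_iff₀ hε] at h1
      linarith

lemma targetMinimaxRisk_lower_bound {d k n : ℕ} {ε σ : ℝ} (hk : 1 ≤ k) (hkd : 2 * k ≤ d)
    (hd : 3 ≤ d) (hn : 1 ≤ n) (hε : 0 < ε) (hσ : 0 < σ) {B₀ : Rep d k}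
    (hB₀ : B₀ ∈ trueReps d k) :
    ENNReal.ofReal (3 / 128 * min 1 (σ ^ 2 * (d : ℝ) / (n : ℝ))) ≤ targetMinimaxRisk d k ε σ n := by
  let i₀ : Fin (d - k) := ⟨0, by omega⟩
  have hcard : (Finset.univ.erase i₀).card = d - k - 1 := by simp
  set m := d - k - 1 with hm
  have hm1 : 1 ≤ m := by omega
  have hm0 : (0 : ℝ) < m := by exact_mod_cast hm1
  have hn0 : (0 : ℝ) < n := by exact_mod_cast hn
  -- `τ²` is the largest value that fits both constraints, unit length of the cube vectors and
  -- indistinguishability.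
  have hτ0 : 0 ≤ min (1 / (m : ℝ)) (σ ^ 2 / n) := by positivity
  have hτ := Real.sq_sqrt hτ0
  set τ := √(min (1 / (m : ℝ)) (σ ^ 2 / n))
  have h1 : (m : ℝ) * τ ^ 2 = min 1 (m * σ ^ 2 / n) := by
    rw [hτ, mul_min_of_nonneg _ _ hm0.le]
    congr 1 <;> field_simp
  have hlow := cube_lower_bound (n := n) (τ := τ) hk hε hσ i₀
    (by rw [hcard, h1]; exact min_le_left _ _)
    (by rw [hτ, ← le_div_iff₀' hn0]; exact min_le_right _ _) hB₀
  refine le_trans (ENNReal.ofReal_le_ofReal ?_) hlow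
  rw [hcard, h1]
  -- From `2k ≤ d` and `3 ≤ d`; the factor is not optimal. It gives the final constant `9/64 / 6 =
  -- 3/128`.
  have h6 : (d : ℝ) ≤ 6 * m := by
    have : d ≤ 6 * m := by omega
    exact_mod_cast this
  have h7 : min 1 (σ ^ 2 * (d : ℝ) / n) ≤ 6 * min 1 (m * σ ^ 2 / n) := by
    rw [mul_min_of_nonneg _ _ (by norm_num : (0 : ℝ) ≤ 6)]
    refine min_le_min (by norm_num) ?_
    rw [← mul_div_assoc]
    refine div_le_div_of_nonneg_right ?_ hn0.le
    linarith [mul_le_mul_of_nonneg_left h6 (sq_nonneg σ)]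
  linarith

/-! ### Moment estimator and the minimax upper bound -/

/-- The fourth moment of the standard Gaussian. -/
def gaussianFourthMoment : ℝ := ∫ x : ℝ, x ^ 4 ∂(gaussianReal 0 1)

lemma gaussianFourthMoment_nonneg : 0 ≤ gaussianFourthMoment :=
  integral_nonneg fun x => by positivity

/-- By scaling. The standard fourth moment is kept as a constant and never evaluated. -/
lemma integral_pow_four_gaussianReal (v : NNReal) :
    ∫ x : ℝ, x ^ 4 ∂(gaussianReal 0 v) = v ^ 2 * gaussianFourthMoment := by
  have h := gaussianReal_map_const_mul (μ := 0) (v := 1) (√(v : ℝ))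
  have hv : NNReal.mk (√(v : ℝ) ^ 2) (sq_nonneg _) * 1 = v := by
    ext; simp
  rw [mul_zero, hv] at h
  rw [← h, integral_map (by fun_prop) (by fun_prop), gaussianFourthMoment, ← integral_const_mul]
  refine integral_congr_ae (Filter.Eventually.of_forall fun x => ?_)
  have : √(v : ℝ) ^ 4 = v ^ 2 := by
    calc √(v : ℝ) ^ 4 = (√(v : ℝ) ^ 2) ^ 2 := by ring
      _ = (v : ℝ) ^ 2 := by rw [Real.sq_sqrt v.coe_nonneg]
  simp only [mul_pow, this]

lemma integral_inner_pow_four {d k : ℕ} {ε : ℝ} (hε : 0 < ε) (a : Vec d k) :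
    ∫ x, inner ℝ x a ^ 4 ∂(inputDist d k ε) = covForm ε a a ^ 2 * gaussianFourthMoment := by
  have h := integral_map (μ := inputDist d k ε) (φ := fun x => inner ℝ x a)
    (f := fun y : ℝ => y ^ 4) (by fun_prop) (by fun_prop)
  rw [map_inner_inputDist hε, integral_pow_four_gaussianReal,
    Real.coe_toNNReal _ (covForm_self_nonneg hε a)] at h
  exact h.symm

/-- The joint law of an input and of the noise. -/
abbrev noisyInput (d k : ℕ) (ε σ : ℝ) : Measure (Vec d k × ℝ) :=
  (inputDist d k ε).prod (gaussianReal 0 (noiseVar σ))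

lemma memLp_inner_fst {d k : ℕ} (ε σ : ℝ) (a : Vec d k) {p : ℝ≥0∞} (hp : p ≠ ∞) :
    MemLp (fun q : Vec d k × ℝ => inner ℝ q.1 a) p (noisyInput d k ε σ) := by
  have h := IsGaussian.memLp_dual (inputDist d k ε) (innerSL ℝ a) p hp
  have h' : MemLp (fun x : Vec d k => inner ℝ x a) p (inputDist d k ε) :=
    (memLp_congr_ae (Filter.Eventually.of_forall fun x => real_inner_comm _ _)).1 h
  exact h'.comp_measurePreserving measurePreserving_fst

lemma memLp_noise {d k : ℕ} (ε σ : ℝ) {p : ℝ≥0∞} (hp : p ≠ ∞) :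
    MemLp (fun q : Vec d k × ℝ => q.2) p (noisyInput d k ε σ) :=
  (memLp_id_gaussianReal' p hp).comp_measurePreserving measurePreserving_snd

/-- Places the product of a feature and a label, both in `L⁴`, in `L²`. -/
instance holderTriple_four : ENNReal.HolderTriple 4 4 2 where
  inv_add_inv_eq_inv := by
    rw [← two_mul, show (4 : ℝ≥0∞) = 2 * 2 by norm_num,
      ENNReal.mul_inv (by norm_num) (by norm_num), ← mul_assoc,
      ENNReal.mul_inv_cancel (by norm_num) (by norm_num), one_mul]

lemma memLp_inner_mul_label {d k : ℕ} (ε σ : ℝ) (a θ : Vec d k) :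
    MemLp (fun q : Vec d k × ℝ => inner ℝ q.1 a * (inner ℝ q.1 θ + q.2)) 2
      (noisyInput d k ε σ) :=
  ((memLp_inner_fst (p := 4) ε σ θ (by norm_num)).add (memLp_noise ε σ (by norm_num))).mul'
    (memLp_inner_fst (p := 4) ε σ a (by norm_num))

lemma integral_inner_mul_label {d k : ℕ} {ε : ℝ} (hε : 0 < ε) (σ : ℝ) (a θ : Vec d k) :
    ∫ q : Vec d k × ℝ, inner ℝ q.1 a * (inner ℝ q.1 θ + q.2) ∂(noisyInput d k ε σ)
      = covForm ε a θ := by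
  have i1 : Integrable (fun q : Vec d k × ℝ => inner ℝ q.1 a * inner ℝ q.1 θ)
      (noisyInput d k ε σ) :=
    (memLp_inner_fst ε σ a (by norm_num)).integrable_mul (p := 2) (q := 2)
      (memLp_inner_fst ε σ θ (by norm_num))
  have i2 : Integrable (fun q : Vec d k × ℝ => inner ℝ q.1 a * q.2) (noisyInput d k ε σ) :=
    (memLp_inner_fst ε σ a (by norm_num)).integrable_mul (p := 2) (q := 2)
      (memLp_noise ε σ (by norm_num))
  simp_rw [mul_add]
  rw [integral_add i1 i2, integral_prod_mul (fun x : Vec d k => inner ℝ x a) (fun y : ℝ => y),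
    integral_inner_inputDist, zero_mul, add_zero,
    integral_fun_fst (fun x : Vec d k => inner ℝ x a * inner ℝ x θ),
    integral_inner_mul_inner_inputDist hε]
  simp

/-- Inputs and signal are dependent, so the cross term `⟨x,a⟩²⟨x,θ⟩²` is split by AM–GM into fourth
powers. The weights `s⁻¹`, `s` balance them: both integrals become multiples of `s`, and the bound
stays linear in the variance along `a`. -/
lemma integral_sq_inner_mul_label_le {d k : ℕ} {ε : ℝ} (hε : 0 < ε) (σ : ℝ) (a θ : Vec d k)
    (ha : 0 < covForm ε a a) (hθ : covForm ε θ θ = 3 / 2) :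
    ∫ q : Vec d k × ℝ, (inner ℝ q.1 a * (inner ℝ q.1 θ + q.2)) ^ 2 ∂(noisyInput d k ε σ)
      ≤ covForm ε a a * ((4 * gaussianFourthMoment + 2) * (1 + σ ^ 2)) := by
  set s := covForm ε a a
  have pow4 : ∀ b : Vec d k, Integrable (fun q : Vec d k × ℝ => inner ℝ q.1 b ^ 4)
      (noisyInput d k ε σ) := fun b => by
    have := (memLp_inner_fst (p := (4 : ℕ)) ε σ b (by norm_num)).integrable_norm_pow (by norm_num)
    refine this.congr (Filter.Eventually.of_forall fun q => ?_)
    simp only [Real.norm_eq_abs]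
    exact Even.pow_abs (by decide) _
  have i1 := (pow4 a).const_mul s⁻¹
  have i2 := (pow4 θ).const_mul s
  have i3 : Integrable (fun q : Vec d k × ℝ => 2 * (inner ℝ q.1 a ^ 2 * q.2 ^ 2))
      (noisyInput d k ε σ) :=
    (Integrable.mul_prod (memLp_inner_inputDist ε a).integrable_sq
      ((memLp_id_gaussianReal (μ := 0) (v := noiseVar σ) 2).integrable_sq)).const_mul 2
  have i12 : Integrable (fun q : Vec d k × ℝ => s⁻¹ * inner ℝ q.1 a ^ 4 + s * inner ℝ q.1 θ ^ 4)
      (noisyInput d k ε σ) := i1.add i2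
  have hle : ∀ q : Vec d k × ℝ, (inner ℝ q.1 a * (inner ℝ q.1 θ + q.2)) ^ 2
      ≤ (s⁻¹ * inner ℝ q.1 a ^ 4 + s * inner ℝ q.1 θ ^ 4) + 2 * (inner ℝ q.1 a ^ 2 * q.2 ^ 2) :=
    fun q => by
    have h1 : 2 * (inner ℝ q.1 a ^ 2 * inner ℝ q.1 θ ^ 2)
        ≤ s⁻¹ * inner ℝ q.1 a ^ 4 + s * inner ℝ q.1 θ ^ 4 := by
      have h2 : 0 ≤ s⁻¹ * (inner ℝ q.1 a ^ 2 - s * inner ℝ q.1 θ ^ 2) ^ 2 := by positivity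
      have h3 : s⁻¹ * (inner ℝ q.1 a ^ 2 - s * inner ℝ q.1 θ ^ 2) ^ 2
          = s⁻¹ * inner ℝ q.1 a ^ 4 + s * inner ℝ q.1 θ ^ 4
            - 2 * (inner ℝ q.1 a ^ 2 * inner ℝ q.1 θ ^ 2) := by
        field_simp
        ring
      linarith
    have h4 : (inner ℝ q.1 a * (inner ℝ q.1 θ + q.2)) ^ 2
        ≤ 2 * (inner ℝ q.1 a ^ 2 * inner ℝ q.1 θ ^ 2) + 2 * (inner ℝ q.1 a ^ 2 * q.2 ^ 2) := by
      nlinarith [sq_nonneg (inner ℝ q.1 a * (inner ℝ q.1 θ - q.2))]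
    linarith
  refine (integral_mono (memLp_inner_mul_label ε σ a θ).integrable_sq (i12.add i3) hle).trans ?_
  simp only [Pi.add_apply]
  have e1 : ∀ b : Vec d k, ∫ q : Vec d k × ℝ, inner ℝ q.1 b ^ 4 ∂(noisyInput d k ε σ)
      = covForm ε b b ^ 2 * gaussianFourthMoment := fun b => by
    rw [integral_fun_fst (fun x : Vec d k => inner ℝ x b ^ 4), integral_inner_pow_four hε]
    simp
  have e2 : ∫ x, inner ℝ x a ^ 2 ∂(inputDist d k ε) = s := by
    simpa [sq] using integral_inner_mul_inner_inputDist hε a a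
  rw [integral_add i12 i3, integral_add i1 i2, integral_const_mul, integral_const_mul,
    integral_const_mul, e1, e1,
    integral_prod_mul (fun x : Vec d k => inner ℝ x a ^ 2) (fun y : ℝ => y ^ 2), e2,
    integral_sq_gaussianReal_noiseVar, hθ]
  have hκ := gaussianFourthMoment_nonneg
  have e3 : s⁻¹ * (s ^ 2 * gaussianFourthMoment) = s * gaussianFourthMoment := by
    field_simp
  rw [e3]
  have h5 : 0 ≤ s * gaussianFourthMoment := mul_nonneg ha.le hκ
  nlinarith [mul_nonneg h5 (sq_nonneg σ)]

/-- The coordinate products `x_i y / Σ_{ii}`, unbiased for `θ_i`. -/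
def coordScore {d k : ℕ} (ε : ℝ) (i : Coord d k) (q : Vec d k × ℝ) : ℝ :=
  q.1 i * q.2 / eig d k ε i

/-- The estimator `Σ⁻¹ n⁻¹ ∑ x_j y_j`. -/
def momentEstimator {d k n : ℕ} (ε : ℝ) (D : Data d k n) : Vec d k :=
  WithLp.toLp 2 fun i => ∑ j, (n : ℝ)⁻¹ * coordScore ε i (D j)

lemma measurable_coordScore {d k : ℕ} (ε : ℝ) (i : Coord d k) : Measurable (coordScore ε i) := by
  unfold coordScore; fun_prop

lemma measurable_momentEstimator {d k n : ℕ} (ε : ℝ) :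
    Measurable (momentEstimator (d := d) (k := k) (n := n) ε) := by
  have := measurable_coordScore (d := d) (k := k) ε
  unfold momentEstimator; fun_prop

lemma covForm_single_left {d k : ℕ} (ε : ℝ) (i : Coord d k) (b : Vec d k) :
    covForm ε (EuclideanSpace.single i 1) b = eig d k ε i * b i := by
  rw [covForm, Fintype.sum_eq_single i fun j hj => by simp [hj]]
  simp

lemma coordScore_eq_inner {d k : ℕ} (ε : ℝ) (i : Coord d k) (θ : Vec d k) (q : Vec d k × ℝ) :
    coordScore ε i (q.1, inner ℝ q.1 θ + q.2)
      = (eig d k ε i)⁻¹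
        * (inner ℝ q.1 (EuclideanSpace.single i 1) * (inner ℝ q.1 θ + q.2)) := by
  rw [coordScore, EuclideanSpace.inner_single_right]
  simp [div_eq_inv_mul]

lemma memLp_coordScore {d k : ℕ} (ε σ : ℝ) (θ : Vec d k) (i : Coord d k) :
    MemLp (coordScore ε i) 2 (sampleDist ε σ θ) := by
  rw [sampleDist_eq, memLp_map_measure_iff (measurable_coordScore ε i).aestronglyMeasurable
    (by fun_prop)]
  have h : (coordScore ε i ∘ fun q : Vec d k × ℝ => (q.1, inner ℝ q.1 θ + q.2))
      = fun q => (eig d k ε i)⁻¹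
        * (inner ℝ q.1 (EuclideanSpace.single i 1) * (inner ℝ q.1 θ + q.2)) :=
    funext fun q => coordScore_eq_inner ε i θ q
  rw [h]
  exact (memLp_inner_mul_label ε σ (EuclideanSpace.single i 1) θ).const_mul _

lemma integral_coordScore {d k : ℕ} {ε : ℝ} (hε : 0 < ε) (σ : ℝ) (θ : Vec d k) (i : Coord d k) :
    ∫ q, coordScore ε i q ∂(sampleDist ε σ θ) = θ i := by
  rw [sampleDist_eq, integral_map (by fun_prop) (measurable_coordScore ε i).aestronglyMeasurable]
  simp_rw [coordScore_eq_inner]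
  rw [integral_const_mul, integral_inner_mul_label hε, covForm_single_left,
    inv_mul_cancel_left₀ (eig_pos hε i).ne']

/-- The factor `Σ_{ii}⁻¹` cancels the weight of coordinate `i` in the excess risk, which makes the
upper bound free of `ε`. -/
lemma integral_sq_coordScore_le {d k : ℕ} {ε : ℝ} (hε : 0 < ε) (σ : ℝ) (θ : Vec d k)
    (hθ : covForm ε θ θ = 3 / 2) (i : Coord d k) :
    ∫ q, coordScore ε i q ^ 2 ∂(sampleDist ε σ θ)
      ≤ (eig d k ε i)⁻¹ * ((4 * gaussianFourthMoment + 2) * (1 + σ ^ 2)) := by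
  have he := eig_pos (k := k) (d := d) hε i
  have hs : covForm ε (EuclideanSpace.single i 1) (EuclideanSpace.single i 1) = eig d k ε i := by
    rw [covForm_single_left]; simp
  rw [sampleDist_eq, integral_map (by fun_prop)
    ((measurable_coordScore ε i).pow_const 2).aestronglyMeasurable]
  simp_rw [coordScore_eq_inner, mul_pow (eig d k ε i)⁻¹]
  rw [integral_const_mul]
  have h := integral_sq_inner_mul_label_le hε σ (EuclideanSpace.single i 1) θ (by rwa [hs]) hθ
  rw [hs] at h
  calc _ ≤ (eig d k ε i)⁻¹ ^ 2
        * (eig d k ε i * ((4 * gaussianFourthMoment + 2) * (1 + σ ^ 2))) := by gcongr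
    _ = _ := by field_simp

/-- The estimator is unbiased, so its mean squared error is a variance, and the variance of an
average of `n` independent scores is `1/n` of that of one score. -/
lemma lintegral_sq_momentEstimator_le {d k n : ℕ} {ε : ℝ} (hε : 0 < ε) (hn : 1 ≤ n) (σ : ℝ)
    (θ : Vec d k) (hθ : covForm ε θ θ = 3 / 2) (i : Coord d k) :
    ∫⁻ D : Data d k n, ENNReal.ofReal (eig d k ε i * (θ i - momentEstimator ε D i) ^ 2)
        ∂(dataDist ε σ n θ)
      ≤ ENNReal.ofReal ((4 * gaussianFourthMoment + 2) * (1 + σ ^ 2) / n) := by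
  have he := eig_pos (k := k) (d := d) hε i
  have hn0 : (n : ℝ) ≠ 0 := by positivity
  set X : Data d k n → ℝ := ∑ j, fun D => (n : ℝ)⁻¹ * coordScore ε i (D j) with hX
  have hXest : ∀ D, momentEstimator ε D i = X D := fun D => by
    simp [momentEstimator, hX, Finset.sum_apply]
  have hmem : ∀ _j : Fin n, MemLp (fun q => (n : ℝ)⁻¹ * coordScore ε i q) 2 (sampleDist ε σ θ) :=
    fun _ => (memLp_coordScore ε σ θ i).const_mul _
  have hmem' : ∀ j : Fin n, MemLp (fun D : Data d k n => (n : ℝ)⁻¹ * coordScore ε i (D j)) 2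
      (dataDist ε σ n θ) := fun j =>
    (hmem j).comp_measurePreserving (measurePreserving_eval (fun _ : Fin n => sampleDist ε σ θ) j)
  have hXmem : MemLp X 2 (dataDist ε σ n θ) := memLp_finsetSum' _ fun j _ => hmem' j
  have hterm : ∀ j : Fin n, ∫ D : Data d k n, (n : ℝ)⁻¹ * coordScore ε i (D j) ∂(dataDist ε σ n θ)
      = (n : ℝ)⁻¹ * θ i := fun j => by
    have h := integral_map (μ := dataDist ε σ n θ) (φ := fun D : Data d k n => D j)
      (f := fun q => (n : ℝ)⁻¹ * coordScore ε i q) (measurable_pi_apply j).aemeasurable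
      ((measurable_coordScore ε i).const_mul _).aestronglyMeasurable
    have hmap := (measurePreserving_eval (fun _ : Fin n => sampleDist ε σ θ) j).map_eq
    rw [← h]
    change ∫ q, _ ∂(Measure.map (Function.eval j) (Measure.pi fun _ => sampleDist ε σ θ)) = _
    rw [hmap, integral_const_mul, integral_coordScore hε]
  have hmean : ∫ D, X D ∂(dataDist ε σ n θ) = θ i := by
    simp only [hX, Finset.sum_apply]
    rw [integral_finsetSum _ fun j _ => (hmem' j).integrable (by norm_num)]
    simp_rw [hterm]
    simp [hn0]
  have hvar : Var[X; dataDist ε σ n θ]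
      ≤ (eig d k ε i)⁻¹ * ((4 * gaussianFourthMoment + 2) * (1 + σ ^ 2) / n) := by
    rw [hX, dataDist, variance_sum_pi hmem]
    simp_rw [variance_const_mul]
    rw [Finset.sum_const, Finset.card_univ, Fintype.card_fin, nsmul_eq_mul]
    have h1 := (variance_le_expectation_sq (μ := sampleDist ε σ θ)
      (measurable_coordScore (d := d) (k := k) ε i).aestronglyMeasurable).trans
      (integral_sq_coordScore_le hε σ θ hθ i)
    calc _ ≤ (n : ℝ) * ((n : ℝ)⁻¹ ^ 2
          * ((eig d k ε i)⁻¹ * ((4 * gaussianFourthMoment + 2) * (1 + σ ^ 2)))) := by gcongr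
      _ = _ := by field_simp
  have hint : Integrable (fun D => (X D - θ i) ^ 2) (dataDist ε σ n θ) :=
    (hXmem.sub (memLp_const (θ i))).integrable_sq
  have hle : ∫ D, eig d k ε i * (X D - θ i) ^ 2 ∂(dataDist ε σ n θ)
      ≤ (4 * gaussianFourthMoment + 2) * (1 + σ ^ 2) / n := by
    rw [integral_const_mul]
    rw [variance_eq_integral hXmem.aemeasurable, hmean] at hvar
    rwa [← le_inv_mul_iff₀ he]
  refine le_trans (le_of_eq ?_) (ENNReal.ofReal_le_ofReal hle)
  rw [ofReal_integral_eq_lintegral_ofReal (hint.const_mul _)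
    (Filter.Eventually.of_forall fun D => by positivity)]
  refine lintegral_congr fun D => ?_
  rw [hXest]
  congr 2
  ring

/-- The part in `E*` contributes `ε / (2ε) = 1/2` and the part in `E_k` contributes 1. -/
lemma covForm_task {d k : ℕ} {ε : ℝ} (hε : 0 < ε) {B : Rep d k} (hB : B ∈ trueReps d k)
    {θ : Vec d k} (hθ : θ ∈ taskSet ε B) : covForm ε θ θ = 3 / 2 := by
  obtain ⟨w, u, hw, hu, rfl⟩ := hθ
  have h1 : ∑ i : Fin (d - k), app B w (Sum.inl i) ^ 2 = 1 := by
    have h := EuclideanSpace.real_norm_sq_eq (app B w)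
    rw [norm_app hB.1, hw, Fintype.sum_sum_type,
      Finset.sum_eq_zero (s := (Finset.univ : Finset (Fin k)))
        fun j _ => by rw [hB.2 w j]; norm_num] at h
    linarith
  have h2 : ∑ j : Fin k, u j ^ 2 = 1 := by
    rw [← EuclideanSpace.real_norm_sq_eq, hu, one_pow]
  have hsq : (Real.sqrt (2 * ε)) ^ 2 = 2 * ε := Real.sq_sqrt (by positivity)
  have e1 : ∀ i : Fin (d - k), eig d k ε (Sum.inl i)
      * (task ε B w u (Sum.inl i) * task ε B w u (Sum.inl i))
      = 1 / 2 * app B w (Sum.inl i) ^ 2 := fun i => by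
    have : task ε B w u (Sum.inl i) * task ε B w u (Sum.inl i)
        = app B w (Sum.inl i) ^ 2 / (Real.sqrt (2 * ε)) ^ 2 := by
      simp [task, embedEk]; ring
    rw [this, hsq]
    simp only [eig, Sum.elim_inl]
    field_simp
  have e2 : ∀ j : Fin k, eig d k ε (Sum.inr j)
      * (task ε B w u (Sum.inr j) * task ε B w u (Sum.inr j)) = u j ^ 2 := fun j => by
    have hj : app B w (Sum.inr j) = 0 := hB.2 w j
    simp [eig, task, embedEk, hj, sq]
  rw [covForm, Fintype.sum_sum_type]
  simp_rw [e1, e2]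
  rw [← Finset.mul_sum, h1, h2]
  norm_num

lemma targetMinimaxRisk_upper_bound {d k n : ℕ} {ε : ℝ} (hkd : k ≤ d) (hε : 0 < ε) (hn : 1 ≤ n)
    (σ : ℝ) :
    targetMinimaxRisk d k ε σ n
      ≤ ENNReal.ofReal ((4 * gaussianFourthMoment + 2) * (1 + σ ^ 2) * (d : ℝ) / (n : ℝ)) := by
  have hm := measurable_momentEstimator (d := d) (k := k) (n := n) ε
  refine iInf₂_le_of_le (Kernel.deterministic _ hm) inferInstance ?_
  refine iSup₂_le fun B hB => iSup₂_le fun θ hθ => ?_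
  have hmeas : Measurable fun v : Vec d k => excessRisk ε θ v := by
    simp_rw [excessRisk_eq hε, covForm]; fun_prop
  simp_rw [Kernel.lintegral_deterministic' hm hmeas]
  have hexp : ∀ D : Data d k n, excessRisk ε θ (momentEstimator ε D)
      = ∑ i, ENNReal.ofReal (eig d k ε i * (θ i - momentEstimator ε D i) ^ 2) := fun D => by
    rw [excessRisk_eq hε, covForm, ENNReal.ofReal_sum_of_nonneg fun i _ =>
      mul_nonneg (eig_pos hε i).le (mul_self_nonneg _)]
    simp only [PiLp.sub_apply, sq]
  simp_rw [hexp]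
  have hcoord : ∀ i, Measurable fun D : Data d k n => momentEstimator ε D i := fun i =>
    (show Measurable fun v : Vec d k => v i by fun_prop).comp hm
  have hterm : ∀ i, Measurable fun D : Data d k n =>
      ENNReal.ofReal (eig d k ε i * (θ i - momentEstimator ε D i) ^ 2) := fun i => by
    have := hcoord i
    fun_prop
  rw [lintegral_finsetSum _ fun i _ => hterm i]
  calc _ ≤ ∑ _i : Coord d k,
        ENNReal.ofReal ((4 * gaussianFourthMoment + 2) * (1 + σ ^ 2) / n) :=
        Finset.sum_le_sum fun i _ =>
          lintegral_sq_momentEstimator_le hε hn σ θ (covForm_task hε hB hθ) i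
    _ = _ := by
      have hc : Fintype.card (Coord d k) = d := by simp; omega
      rw [Finset.sum_const, Finset.card_univ, hc, nsmul_eq_mul, ← ENNReal.ofReal_natCast,
        ← ENNReal.ofReal_mul (Nat.cast_nonneg _)]
      congr 1
      ring

/-! ### Second moments of the uniform law on the sphere -/

section Sphere

open scoped Pointwise

variable {k : ℕ}

lemma nontrivial_weight (hk : 1 ≤ k) : Nontrivial (Weight k) := by
  have : Nonempty (Fin k) := ⟨⟨0, hk⟩⟩
  exact (WithLp.toLp_injective 2).nontrivial

lemma isProbabilityMeasure_unifSphere (hk : 1 ≤ k) : IsProbabilityMeasure (unifSphere k) := by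
  have := nontrivial_weight hk
  have : NeZero (volume : Measure (Weight k)).toSphere := ⟨Measure.toSphere_ne_zero _⟩
  exact Measure.isProbabilityMeasure_map (by fun_prop)

lemma ae_norm_eq_one_unifSphere (k : ℕ) : ∀ᵐ w ∂(unifSphere k), ‖w‖ = 1 := by
  rw [unifSphere, ae_map_iff (by fun_prop) (measurableSet_eq_fun (by fun_prop) (by fun_prop))]
  exact Filter.Eventually.of_forall fun w => by simp

lemma unifSphere_apply {t : Set (Weight k)} (ht : MeasurableSet t) :
    unifSphere k t = ((volume : Measure (Weight k)).toSphere Set.univ)⁻¹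
      * (Module.finrank ℝ (Weight k)
        * volume (Set.Ioo (0 : ℝ) 1 • (Metric.sphere (0 : Weight k) 1 ∩ t))) := by
  rw [unifSphere, Measure.map_apply (by fun_prop) ht, Measure.smul_apply,
    Measure.toSphere_apply' _ (measurable_subtype_coe ht), Subtype.image_preimage_coe, smul_eq_mul]

/-- The sphere measure is the volume of a cone up to a constant. Isometries map cones to cones and
preserve volume. -/
lemma measurePreserving_unifSphere (T : Weight k ≃ₗᵢ[ℝ] Weight k) :
    MeasurePreserving T (unifSphere k) (unifSphere k) := by
  have hT : Measurable T := T.continuous.measurable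
  refine ⟨hT, Measure.ext fun t ht => ?_⟩
  rw [Measure.map_apply hT ht, unifSphere_apply (hT ht), unifSphere_apply ht]
  congr 2
  have hset : Set.Ioo (0 : ℝ) 1 • (Metric.sphere (0 : Weight k) 1 ∩ T ⁻¹' t)
      = T ⁻¹' (Set.Ioo (0 : ℝ) 1 • (Metric.sphere (0 : Weight k) 1 ∩ t)) := by
    ext x
    simp only [Set.mem_smul, Set.mem_inter_iff, mem_sphere_zero_iff_norm, Set.mem_preimage]
    constructor
    · rintro ⟨r, hr, y, ⟨hy1, hy2⟩, rfl⟩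
      exact ⟨r, hr, T y, ⟨by simpa using hy1, hy2⟩, by simp⟩
    · rintro ⟨r, hr, y, ⟨hy1, hy2⟩, h⟩
      refine ⟨r, hr, T.symm y, ⟨by simpa using hy1, by simpa using hy2⟩, ?_⟩
      rw [← map_smul, h, T.symm_apply_apply]
  rw [hset]
  exact T.measurePreserving.measure_preimage_emb T.toHomeomorph.measurableEmbedding _

lemma integral_comp_unifSphere (T : Weight k ≃ₗᵢ[ℝ] Weight k) (f : Weight k → ℝ) :
    ∫ w, f (T w) ∂(unifSphere k) = ∫ w, f w ∂(unifSphere k) :=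
  (measurePreserving_unifSphere T).integral_comp T.toHomeomorph.measurableEmbedding f

lemma integrable_mul_unifSphere (hk : 1 ≤ k) (i j : Fin k) :
    Integrable (fun w : Weight k => w i * w j) (unifSphere k) := by
  have := isProbabilityMeasure_unifSphere hk
  refine Integrable.of_bound (by fun_prop) 1 ?_
  filter_upwards [ae_norm_eq_one_unifSphere k] with w hw
  have h : ∀ i, ‖w i‖ ≤ 1 := fun i => hw ▸ PiLp.norm_apply_le w i
  rw [norm_mul]
  exact mul_le_one₀ (h i) (norm_nonneg _) (h j)

/-- The sign change of one coordinate. -/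
def signFlip (i : Fin k) : Weight k ≃ₗᵢ[ℝ] Weight k :=
  LinearIsometryEquiv.piLpCongrRight 2
    (fun j => if j = i then LinearIsometryEquiv.neg ℝ else LinearIsometryEquiv.refl ℝ ℝ)

lemma signFlip_apply_self (i : Fin k) (w : Weight k) : signFlip i w i = -w i := by
  simp [signFlip]

lemma signFlip_apply_of_ne {i j : Fin k} (h : j ≠ i) (w : Weight k) : signFlip i w j = w j := by
  simp [signFlip, h]

lemma integral_mul_unifSphere_of_ne {i j : Fin k} (h : i ≠ j) :
    ∫ w : Weight k, w i * w j ∂(unifSphere k) = 0 := by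
  have h1 := integral_comp_unifSphere (signFlip i) (fun w => w i * w j)
  simp only [signFlip_apply_self, signFlip_apply_of_ne h.symm, neg_mul, integral_neg] at h1
  linarith

/-- Coordinate swaps make the `k` second moments equal, and they sum to 1. -/
lemma integral_sq_unifSphere (hk : 1 ≤ k) (i : Fin k) :
    ∫ w : Weight k, w i * w i ∂(unifSphere k) = (k : ℝ)⁻¹ := by
  have := isProbabilityMeasure_unifSphere hk
  have hsym : ∀ j : Fin k, ∫ w : Weight k, w j * w j ∂(unifSphere k)
      = ∫ w : Weight k, w i * w i ∂(unifSphere k) := fun j => by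
    have h1 := integral_comp_unifSphere
      (LinearIsometryEquiv.piLpCongrLeft 2 ℝ ℝ (Equiv.swap i j)) (fun w => w i * w i)
    simpa using h1
  have hsum : ∑ j, ∫ w : Weight k, w j * w j ∂(unifSphere k) = 1 := by
    rw [← integral_finsetSum _ fun j _ => integrable_mul_unifSphere hk j j]
    have : (fun w : Weight k => ∑ j, w j * w j) =ᵐ[unifSphere k] fun _ => 1 := by
      filter_upwards [ae_norm_eq_one_unifSphere k] with w hw
      have := EuclideanSpace.real_norm_sq_eq w
      rw [hw] at this
      simp only [← sq]
      linarith
    rw [integral_congr_ae this]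
    simp
  rw [Finset.sum_congr rfl fun j _ => hsym j, Finset.sum_const, Finset.card_univ,
    Fintype.card_fin, nsmul_eq_mul] at hsum
  exact eq_inv_of_mul_eq_one_right hsum

variable {E : Type*} [NormedAddCommGroup E] [InnerProductSpace ℝ E]

lemma linearMap_eq_sum (F : Weight k →ₗ[ℝ] E) (w : Weight k) :
    F w = ∑ i, w i • F (EuclideanSpace.single i 1) := by
  conv_lhs => rw [← (EuclideanSpace.basisFun (Fin k) ℝ).sum_repr w]
  simp [map_sum]

lemma norm_sq_linearMap_eq_sum (F : Weight k →ₗ[ℝ] E) (w : Weight k) :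
    ‖F w‖ ^ 2 = ∑ i, ∑ j, (w i * w j)
      * inner ℝ (F (EuclideanSpace.single i 1)) (F (EuclideanSpace.single j 1)) := by
  rw [← real_inner_self_eq_norm_sq, linearMap_eq_sum F w, sum_inner]
  simp_rw [inner_sum, real_inner_smul_left, real_inner_smul_right]
  exact Finset.sum_congr rfl fun i _ => Finset.sum_congr rfl fun j _ => by ring

lemma integrable_norm_sq_unifSphere (hk : 1 ≤ k) (F : Weight k →ₗ[ℝ] E) :
    Integrable (fun w => ‖F w‖ ^ 2) (unifSphere k) := by
  simp_rw [norm_sq_linearMap_eq_sum]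
  exact integrable_finsetSum _ fun i _ => integrable_finsetSum _ fun j _ =>
    (integrable_mul_unifSphere hk i j).mul_const _

lemma integral_norm_sq_unifSphere (hk : 1 ≤ k) (F : Weight k →ₗ[ℝ] E) :
    ∫ w, ‖F w‖ ^ 2 ∂(unifSphere k) = (k : ℝ)⁻¹ * ∑ i, ‖F (EuclideanSpace.single i 1)‖ ^ 2 := by
  simp_rw [norm_sq_linearMap_eq_sum F]
  rw [integral_finsetSum _ fun i _ => integrable_finsetSum _ fun j _ =>
    (integrable_mul_unifSphere hk i j).mul_const _, Finset.mul_sum]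
  refine Finset.sum_congr rfl fun i _ => ?_
  rw [integral_finsetSum _ fun j _ => (integrable_mul_unifSphere hk i j).mul_const _,
    Finset.sum_eq_single i]
  · rw [integral_mul_const, integral_sq_unifSphere hk, ← norm_sq_linearMap_eq_sum,
      real_inner_self_eq_norm_sq]
  · intro j _ hj
    rw [integral_mul_const, integral_mul_unifSphere_of_ne hj.symm, zero_mul]
  · simp

/-- Odd under `w ↦ -w` in the first factor, which preserves the product law. -/
lemma integral_inner_unifSphere_prod (hk : 1 ≤ k) (F G : Weight k →ₗ[ℝ] E) :
    ∫ q : Weight k × Weight k, inner ℝ (F q.1) (G q.2) ∂((unifSphere k).prod (unifSphere k)) = 0 := by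
  have := isProbabilityMeasure_unifSphere hk
  have hmp : MeasurePreserving (Prod.map (fun w : Weight k => -w) (id : Weight k → Weight k))
      ((unifSphere k).prod (unifSphere k)) ((unifSphere k).prod (unifSphere k)) :=
    (measurePreserving_unifSphere (LinearIsometryEquiv.neg ℝ)).prod (MeasurePreserving.id _)
  have h := hmp.integral_comp (((MeasurableEquiv.neg (Weight k)).prodCongr
    (MeasurableEquiv.refl (Weight k))).measurableEmbedding)
    (fun q : Weight k × Weight k => inner ℝ (F q.1) (G q.2))
  simp only [Prod.map_fst, Prod.map_snd, map_neg, inner_neg_left, integral_neg, id] at h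
  linarith

lemma integral_norm_sq_add_unifSphere_prod [FiniteDimensional ℝ E] (hk : 1 ≤ k)
    (F G : Weight k →ₗ[ℝ] E) :
    ∫ q : Weight k × Weight k, ‖F q.1 + G q.2‖ ^ 2 ∂((unifSphere k).prod (unifSphere k))
      = (k : ℝ)⁻¹ * ∑ i, ‖F (EuclideanSpace.single i 1)‖ ^ 2
        + (k : ℝ)⁻¹ * ∑ i, ‖G (EuclideanSpace.single i 1)‖ ^ 2 := by
  have := isProbabilityMeasure_unifSphere hk
  have hF : Continuous F := F.continuous_of_finiteDimensional
  have hG : Continuous G := G.continuous_of_finiteDimensional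
  have i1 : Integrable (fun q : Weight k × Weight k => ‖F q.1‖ ^ 2)
      ((unifSphere k).prod (unifSphere k)) := (integrable_norm_sq_unifSphere hk F).comp_fst _
  have i2 : Integrable (fun q : Weight k × Weight k => ‖G q.2‖ ^ 2)
      ((unifSphere k).prod (unifSphere k)) := (integrable_norm_sq_unifSphere hk G).comp_snd _
  have i3 : Integrable (fun q : Weight k × Weight k => 2 * inner ℝ (F q.1) (G q.2))
      ((unifSphere k).prod (unifSphere k)) := by
    refine (i1.add i2).mono' (by fun_prop) (Filter.Eventually.of_forall fun q => ?_)
    have h1 := abs_real_inner_le_norm (F q.1) (G q.2)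
    rw [norm_mul, Real.norm_eq_abs, Real.norm_eq_abs, abs_two]
    simp only [Pi.add_apply]
    nlinarith [sq_nonneg (‖F q.1‖ - ‖G q.2‖)]
  have i13 : Integrable (fun q : Weight k × Weight k =>
      ‖F q.1‖ ^ 2 + 2 * inner ℝ (F q.1) (G q.2)) ((unifSphere k).prod (unifSphere k)) := i1.add i3
  simp_rw [norm_add_sq_real]
  rw [integral_add i13 i2, integral_add i1 i3, integral_const_mul,
    integral_inner_unifSphere_prod hk, integral_fun_fst (fun w : Weight k => ‖F w‖ ^ 2),
    integral_fun_snd (fun w : Weight k => ‖G w‖ ^ 2), integral_norm_sq_unifSphere hk,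
    integral_norm_sq_unifSphere hk]
  simp

end Sphere

/-! ### Whitened projections and the characterization of FrozenRep minimizers -/

/-- Expand the projections in an orthonormal basis of `V`, exchange the sums, and apply Bessel's
inequality to each basis vector. -/
lemma sum_norm_sq_starProjection_le {E ι : Type*} [NormedAddCommGroup E] [InnerProductSpace ℝ E]
    [FiniteDimensional ℝ E] [Fintype ι] {x : ι → E} (hx : Orthonormal ℝ x) (V : Submodule ℝ E) :
    ∑ i, ‖V.starProjection (x i)‖ ^ 2 ≤ Module.finrank ℝ V := by
  let f := stdOrthonormalBasis ℝ V
  have h1 : ∀ y, ‖V.starProjection y‖ ^ 2 = ∑ l, ‖inner ℝ y (f l : E)‖ ^ 2 := fun y => by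
    have h := f.sum_sq_norm_inner_left (V.orthogonalProjectionOnto y)
    change ‖V.orthogonalProjectionOnto y‖ ^ 2 = _
    rw [← h]
    refine Finset.sum_congr rfl fun l _ => ?_
    rw [Submodule.inner_orthogonalProjectionOnto_eq_of_mem_right]
  simp_rw [h1]
  rw [Finset.sum_comm]
  calc ∑ l, ∑ i, ‖inner ℝ (x i) (f l : E)‖ ^ 2 ≤ ∑ l, ‖(f l : E)‖ ^ 2 :=
        Finset.sum_le_sum fun l _ => hx.sum_inner_products_le (f l : E)
    _ = Module.finrank ℝ V := by
        have : ∀ l, ‖(f l : E)‖ = 1 := fun l => f.orthonormal.1 l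
        simp [this]

/-- The square root `Σ^{1/2}`. -/
def sqrtCov (d k : ℕ) (ε : ℝ) : Vec d k →ₗ[ℝ] Vec d k :=
  Matrix.toEuclideanLin (Matrix.diagonal fun i => √(eig d k ε i))

lemma sqrtCov_apply {d k : ℕ} (ε : ℝ) (v : Vec d k) (i : Coord d k) :
    sqrtCov d k ε v i = √(eig d k ε i) * v i := by
  simp [sqrtCov, Matrix.mulVec_diagonal]

lemma covForm_self_eq {d k : ℕ} {ε : ℝ} (hε : 0 < ε) (v : Vec d k) :
    covForm ε v v = ‖sqrtCov d k ε v‖ ^ 2 := by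
  rw [EuclideanSpace.real_norm_sq_eq, covForm]
  refine Finset.sum_congr rfl fun i _ => ?_
  rw [sqrtCov_apply, mul_pow, Real.sq_sqrt (eig_pos hε i).le, sq]

/-- The column span of `Σ^{1/2} B`. -/
def whitenedSpan {d k : ℕ} (ε : ℝ) (B : Rep d k) : Submodule ℝ (Vec d k) :=
  LinearMap.range (sqrtCov d k ε ∘ₗ Matrix.toEuclideanLin B)

lemma finrank_whitenedSpan_le {d k : ℕ} (ε : ℝ) (B : Rep d k) :
    Module.finrank ℝ (whitenedSpan ε B) ≤ k :=
  (LinearMap.finrank_range_le (sqrtCov d k ε ∘ₗ Matrix.toEuclideanLin B)).trans_eq (by simp)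

/-- The part of a vector orthogonal to the column span of `Σ^{1/2} B`. -/
def residual {d k : ℕ} (ε : ℝ) (B : Rep d k) : Vec d k →ₗ[ℝ] Vec d k :=
  (whitenedSpan ε B)ᗮ.starProjection.toLinearMap

lemma norm_residual_le {d k : ℕ} (ε : ℝ) (B : Rep d k) (v : Vec d k) : ‖residual ε B v‖ ≤ ‖v‖ :=
  Submodule.norm_starProjection_apply_le _ _

lemma norm_sq_residual_add {d k : ℕ} (ε : ℝ) (B : Rep d k) (v : Vec d k) :
    ‖v‖ ^ 2 = ‖(whitenedSpan ε B).starProjection v‖ ^ 2 + ‖residual ε B v‖ ^ 2 :=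
  Submodule.norm_sq_eq_add_norm_sq_starProjection v _

/-- Fitting `w` is least squares in whitened coordinates. The minimum is attained at the orthogonal
projection of the task onto the whitened span. -/
lemma iInf_popLoss {d k : ℕ} {ε : ℝ} (hε : 0 < ε) (σ : ℝ) (θ : Vec d k) (B : Rep d k) :
    ⨅ w : Weight k, popLoss ε σ θ (app B w)
      = (1 / 2) * (‖residual ε B (sqrtCov d k ε θ)‖ ^ 2 + σ ^ 2) := by
  have hloss : ∀ w, popLoss ε σ θ (app B w)
      = (1 / 2) * (‖sqrtCov d k ε θ - sqrtCov d k ε (app B w)‖ ^ 2 + σ ^ 2) := fun w => by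
    rw [popLoss_eq hε, covForm_self_eq hε, map_sub]
  have hres : ∀ w, residual ε B (sqrtCov d k ε θ)
      = residual ε B (sqrtCov d k ε θ - sqrtCov d k ε (app B w)) := fun w => by
    have : residual ε B (sqrtCov d k ε (app B w)) = 0 :=
      (Submodule.starProjection_apply_eq_zero_iff _).2
        (Submodule.le_orthogonal_orthogonal _ ⟨w, rfl⟩)
    rw [map_sub, this, sub_zero]
  have hlow : ∀ w, (1 / 2) * (‖residual ε B (sqrtCov d k ε θ)‖ ^ 2 + σ ^ 2)
      ≤ popLoss ε σ θ (app B w) := fun w => by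
    rw [hloss, hres w]
    gcongr
    exact norm_residual_le _ _ _
  obtain ⟨w₀, hw₀⟩ : (whitenedSpan ε B).starProjection (sqrtCov d k ε θ) ∈ whitenedSpan ε B :=
    Submodule.starProjection_apply_mem _ _
  refine le_antisymm ?_ (le_ciInf hlow)
  refine (ciInf_le ⟨_, Set.forall_mem_range.2 hlow⟩ w₀).trans (le_of_eq ?_)
  have hw₀' : sqrtCov d k ε (app B w₀)
      = (whitenedSpan ε B).starProjection (sqrtCov d k ε θ) := hw₀
  rw [hloss, hw₀', residual]
  simp [Submodule.starProjection_orthogonal]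

/-- The matrix whose columns are the last `k` coordinate vectors. -/
def lastRep (d k : ℕ) : Rep d k := Matrix.fromRows 0 1

lemma embedEk_eq_app {d k : ℕ} (u : Weight k) : embedEk d k u = app (lastRep d k) u := by
  ext i
  rcases i with i | i <;>
    simp [embedEk, app, lastRep, Matrix.fromRows_mulVec]

lemma sqrtCov_embedEk {d k : ℕ} (ε : ℝ) (u : Weight k) :
    sqrtCov d k ε (embedEk d k u) = embedEk d k u := by
  ext i
  rcases i with i | i <;> simp [sqrtCov_apply, embedEk, eig]

/-- Whitening turns `1/√(2ε)` into `1/√2 < 1`: this is why the source objective prefers `E_k` to the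
columns of `B*`. -/
lemma sqrtCov_task {d k : ℕ} {ε : ℝ} (hε : 0 < ε) {B : Rep d k} (hB : B ∈ trueReps d k)
    (w u : Weight k) :
    sqrtCov d k ε (task ε B w u) = (1 / √2 : ℝ) • app B w + embedEk d k u := by
  rw [task, map_add, sqrtCov_embedEk, map_smul]
  congr 1
  ext i
  rcases i with i | i
  · have : √ε ≠ 0 := by positivity
    simp only [PiLp.smul_apply, sqrtCov_apply, eig, Sum.elim_inl, smul_eq_mul]
    rw [Real.sqrt_mul (by norm_num)]
    field_simp
  · have : app B w (Sum.inr i) = 0 := hB.2 w i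
    simp [sqrtCov_apply, this]

/-- The total residual energy of the columns of `A`. -/
def residualEnergy {d k : ℕ} (ε : ℝ) (B A : Rep d k) : ℝ :=
  ∑ i, ‖residual ε B (app A (EuclideanSpace.single i 1))‖ ^ 2

lemma residualEnergy_nonneg {d k : ℕ} (ε : ℝ) (B A : Rep d k) : 0 ≤ residualEnergy ε B A :=
  Finset.sum_nonneg fun _ _ => sq_nonneg _

/-- Independence and symmetry of `w` and `δ` remove the cross terms, so the objective sees `B` only
through two residual energies, with weights `1/2` and `1`. -/
lemma frozenObjective_eq {d k : ℕ} {ε : ℝ} (hk : 1 ≤ k) (hε : 0 < ε) (σ : ℝ) {Bstar : Rep d k}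
    (hB : Bstar ∈ trueReps d k) (B : Rep d k) :
    frozenObjective ε σ Bstar B
      = (1 / 2) * ((k : ℝ)⁻¹ * ((1 / 2) * residualEnergy ε B Bstar
        + residualEnergy ε B (lastRep d k)) + σ ^ 2) := by
  have := isProbabilityMeasure_unifSphere hk
  have happ : ∀ A : Rep d k, Continuous fun w => app A w := fun A =>
    (Matrix.toEuclideanLin A).continuous_of_finiteDimensional
  have hres : Continuous (residual ε B) := (residual ε B).continuous_of_finiteDimensional
  have hcov : Continuous (sqrtCov d k ε) := (sqrtCov d k ε).continuous_of_finiteDimensional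
  have htask : Measurable fun q : Weight k × Weight k => task ε Bstar q.1 q.2 := by
    simp only [task, embedEk_eq_app]
    have h1 := happ Bstar
    have h2 := happ (lastRep d k)
    exact Continuous.measurable (by fun_prop)
  rw [frozenObjective, taskDist]
  simp_rw [iInf_popLoss hε]
  rw [integral_map htask.aemeasurable (Continuous.aestronglyMeasurable (by fun_prop))]
  simp_rw [sqrtCov_task hε hB, map_add]
  let F : Weight k →ₗ[ℝ] Vec d k := (1 / √2 : ℝ) • (residual ε B ∘ₗ Matrix.toEuclideanLin Bstar)
  let G : Weight k →ₗ[ℝ] Vec d k := residual ε B ∘ₗ Matrix.toEuclideanLin (lastRep d k)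
  have hFG : ∀ q : Weight k × Weight k,
      residual ε B ((1 / √2 : ℝ) • app Bstar q.1) + residual ε B (embedEk d k q.2)
        = F q.1 + G q.2 := fun q => by
    rw [map_smul, embedEk_eq_app]; rfl
  simp_rw [hFG]
  have key := integral_norm_sq_add_unifSphere_prod hk F G
  have hF : Continuous F := F.continuous_of_finiteDimensional
  have hG : Continuous G := G.continuous_of_finiteDimensional
  have hint : Integrable (fun q : Weight k × Weight k => ‖F q.1 + G q.2‖ ^ 2)
      ((unifSphere k).prod (unifSphere k)) := by
    refine (((integrable_norm_sq_unifSphere hk F).comp_fst (unifSphere k)).const_mul 2 |>.add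
      (((integrable_norm_sq_unifSphere hk G).comp_snd (unifSphere k)).const_mul 2)).mono'
      (by fun_prop) (Filter.Eventually.of_forall fun q => ?_)
    rw [Real.norm_of_nonneg (sq_nonneg _)]
    simp only [Pi.add_apply]
    have h1 := norm_add_le (F q.1) (G q.2)
    nlinarith [sq_nonneg (‖F q.1‖ - ‖G q.2‖), norm_nonneg (F q.1 + G q.2)]
  rw [integral_const_mul, integral_add hint (integrable_const _), key]
  have hF1 : ∀ i, ‖F (EuclideanSpace.single i 1)‖ ^ 2
      = (1 / 2) * ‖residual ε B (app Bstar (EuclideanSpace.single i 1))‖ ^ 2 := fun i => by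
    have : F (EuclideanSpace.single i 1)
      = (1 / √2 : ℝ) • residual ε B (app Bstar (EuclideanSpace.single i 1)) := rfl
    rw [this, norm_smul, mul_pow, Real.norm_eq_abs, sq_abs, div_pow, Real.sq_sqrt (by norm_num)]
    norm_num
  simp_rw [hF1, ← Finset.mul_sum]
  simp only [integral_const, probReal_univ, one_smul]
  change (1 / 2) * ((k : ℝ)⁻¹ * ((1 / 2) * residualEnergy ε B Bstar)
    + (k : ℝ)⁻¹ * residualEnergy ε B (lastRep d k) + σ ^ 2) = _
  ring

lemma orthonormal_columns {d k : ℕ} {B : Rep d k} (hB : B ∈ trueReps d k) :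
    Orthonormal ℝ (Sum.elim (fun i : Fin k => app B (EuclideanSpace.single i 1))
      (fun j : Fin k => embedEk d k (EuclideanSpace.single j 1))) := by
  let L : Weight k →ₗᵢ[ℝ] Vec d k := ⟨Matrix.toEuclideanLin B, norm_app hB.1⟩
  have h1 : ∀ i j : Fin k, inner ℝ (app B (EuclideanSpace.single i 1))
      (app B (EuclideanSpace.single j 1)) = if i = j then (1 : ℝ) else 0 := fun i j => by
    refine (L.inner_map_map (EuclideanSpace.single i 1) (EuclideanSpace.single j 1)).trans ?_
    rw [EuclideanSpace.inner_single_left]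
    simp
  have h2 : ∀ i j : Fin k, inner ℝ (embedEk d k (EuclideanSpace.single i 1))
      (embedEk d k (EuclideanSpace.single j 1)) = if i = j then (1 : ℝ) else 0 := fun i j => by
    simp [embedEk, PiLp.inner_apply, Fintype.sum_sum_type, eq_comm]
  have h3 : ∀ i j : Fin k, inner ℝ (app B (EuclideanSpace.single i 1))
      (embedEk d k (EuclideanSpace.single j 1)) = (0 : ℝ) := fun i j => by
    have h := hB.2 (EuclideanSpace.single i 1)
    change ∀ j : Fin k, _ = (0 : ℝ) at h
    simp [embedEk, PiLp.inner_apply, Fintype.sum_sum_type, h]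
  rw [orthonormal_iff_ite]
  rintro (i | i) (j | j)
  · simpa using h1 i j
  · simpa using h3 i j
  · rw [real_inner_comm]; simpa using h3 j i
  · simpa using h2 i j

/-- Of `2k` orthonormal vectors, a space of dimension at most `k` captures total energy at most `k`.
-/
lemma le_residualEnergy_add {d k : ℕ} (ε : ℝ) {Bstar : Rep d k} (hB : Bstar ∈ trueReps d k)
    (B : Rep d k) : (k : ℝ) ≤ residualEnergy ε B Bstar + residualEnergy ε B (lastRep d k) := by
  have ho := orthonormal_columns hB
  have h1 := sum_norm_sq_starProjection_le ho (whitenedSpan ε B)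
  have h2 : ∀ i, ‖residual ε B (Sum.elim (fun i : Fin k => app Bstar (EuclideanSpace.single i 1))
      (fun j : Fin k => embedEk d k (EuclideanSpace.single j 1)) i)‖ ^ 2
      = 1 - ‖(whitenedSpan ε B).starProjection
        (Sum.elim (fun i : Fin k => app Bstar (EuclideanSpace.single i 1))
      (fun j : Fin k => embedEk d k (EuclideanSpace.single j 1)) i)‖ ^ 2 := fun i => by
    have := norm_sq_residual_add ε B (Sum.elim
      (fun i : Fin k => app Bstar (EuclideanSpace.single i 1))
      (fun j : Fin k => embedEk d k (EuclideanSpace.single j 1)) i)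
    rw [ho.1 i] at this
    linarith
  have h3 : residualEnergy ε B Bstar + residualEnergy ε B (lastRep d k)
      = ∑ i, ‖residual ε B (Sum.elim (fun i : Fin k => app Bstar (EuclideanSpace.single i 1))
      (fun j : Fin k => embedEk d k (EuclideanSpace.single j 1)) i)‖ ^ 2 := by
    rw [Fintype.sum_sum_type]
    simp only [residualEnergy, Sum.elim_inl, Sum.elim_inr, embedEk_eq_app]
  rw [h3, Finset.sum_congr rfl fun i _ => h2 i, Finset.sum_sub_distrib]
  have h4 : (Module.finrank ℝ (whitenedSpan ε B) : ℝ) ≤ k := by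
    exact_mod_cast finrank_whitenedSpan_le ε B
  simp only [Finset.sum_const, Finset.card_univ, Fintype.card_sum, Fintype.card_fin, nsmul_eq_mul,
    Nat.cast_add, mul_one]
  linarith

lemma residualEnergy_le {d k : ℕ} (ε : ℝ) {A : Rep d k} (hA : A ∈ trueReps d k)
    (B : Rep d k) : residualEnergy ε B A ≤ k := by
  calc residualEnergy ε B A ≤ ∑ _i : Fin k, (1 : ℝ) := Finset.sum_le_sum fun i _ => by
        have h := norm_residual_le ε B (app A (EuclideanSpace.single i 1))
        rw [norm_app hA.1, PiLp.norm_single, norm_one] at h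
        exact pow_le_one₀ (norm_nonneg _) h
    _ = k := by simp

lemma residualEnergy_lastRep_self {d k : ℕ} (ε : ℝ) :
    residualEnergy ε (lastRep d k) (lastRep d k) = 0 := by
  refine Finset.sum_eq_zero fun i _ => ?_
  have : residual ε (lastRep d k) (app (lastRep d k) (EuclideanSpace.single i 1)) = 0 := by
    refine (Submodule.starProjection_apply_eq_zero_iff _).2
      (Submodule.le_orthogonal_orthogonal _ ⟨EuclideanSpace.single i 1, ?_⟩)
    change sqrtCov d k ε (app (lastRep d k) _) = _
    rw [← embedEk_eq_app, sqrtCov_embedEk]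
  rw [this]
  simp

/-- The FrozenRep representations are the matrices whose whitened column span contains `E_k`,
whatever the ground truth. -/
lemma isFrozenRep_iff {d k : ℕ} {ε : ℝ} (hk : 1 ≤ k) (hε : 0 < ε) (σ : ℝ) {Bstar : Rep d k}
    (hB : Bstar ∈ trueReps d k) (B : Rep d k) :
    IsFrozenRep ε σ Bstar B ↔ residualEnergy ε B (lastRep d k) = 0 := by
  have hk0 : (0 : ℝ) < k := by exact_mod_cast hk
  constructor
  · intro h
    have h1 := h (lastRep d k)
    rw [frozenObjective_eq hk hε σ hB, frozenObjective_eq hk hε σ hB, residualEnergy_lastRep_self]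
      at h1
    have h2 := residualEnergy_le ε hB (lastRep d k)
    have h3 := le_residualEnergy_add ε hB B
    have h4 : (k : ℝ)⁻¹ * ((1 / 2) * residualEnergy ε B Bstar + residualEnergy ε B (lastRep d k))
        ≤ (k : ℝ)⁻¹ * ((1 / 2) * residualEnergy ε (lastRep d k) Bstar + 0) := by linarith
    have h5 := le_of_mul_le_mul_left h4 (inv_pos.2 hk0)
    -- Write `e*` and `e` for the residual energies of `B*` and of `E_k`. Comparison with `lastRep`
    -- gives `e*/2 + e ≤ k/2`, while `e* ≥ k - e`; hence `e ≤ 0`.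
    linarith [residualEnergy_nonneg ε B (lastRep d k)]
  · intro h B'
    rw [frozenObjective_eq hk hε σ hB, frozenObjective_eq hk hε σ hB, h]
    have h2 := residualEnergy_le ε hB B
    have h3 := le_residualEnergy_add ε hB B'
    gcongr (1 / 2) * ((k : ℝ)⁻¹ * ?_ + σ ^ 2)
    linarith [residualEnergy_nonneg ε B' (lastRep d k)]

/-! ### Equality of the two minimax risks -/

lemma measurable_app {d k : ℕ} (B : Rep d k) : Measurable fun w : Weight k => app B w :=
  (Matrix.toEuclideanLin B).continuous_of_finiteDimensional.measurable

/-- A target-only procedure is run with `ŵ = 0`, and the supremum on the frozen side ranges over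
fewer ground truths. -/
lemma frozenMinimaxRisk_le_targetMinimaxRisk {d k : ℕ} (ε σ : ℝ) (n : ℕ) (Bhat : Rep d k) :
    frozenMinimaxRisk ε σ n Bhat ≤ targetMinimaxRisk d k ε σ n := by
  refine le_iInf₂ fun A hA => ?_
  have hm : Measurable fun v : Vec d k => ((0 : Weight k), v) := by fun_prop
  have : IsMarkovKernel (A.map fun v : Vec d k => ((0 : Weight k), v)) := Kernel.IsMarkovKernel.map A hm
  refine iInf₂_le_of_le (A.map fun v => (0, v)) this ?_
  refine iSup₂_le fun B hB => le_iSup₂_of_le B hB.1 (iSup₂_mono fun θ _ => ?_)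
  refine lintegral_mono fun D => ?_
  rw [Kernel.map_apply _ hm]
  refine (lintegral_map_le _ _).trans (le_of_eq ?_)
  simp [app]

/-- The map `(w, δ) ↦ Bhat w + δ` turns a frozen procedure into a target-only one. The supremum does
not grow, since a FrozenRep representation for one ground truth is one for all. -/
lemma targetMinimaxRisk_le_frozenMinimaxRisk {d k : ℕ} {ε : ℝ} (hk : 1 ≤ k) (hε : 0 < ε) (σ : ℝ)
    (n : ℕ) {Bstar Bhat : Rep d k} (hB : Bstar ∈ trueReps d k)
    (hBhat : IsFrozenRep ε σ Bstar Bhat) :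
    targetMinimaxRisk d k ε σ n ≤ frozenMinimaxRisk ε σ n Bhat := by
  refine le_iInf₂ fun A hA => ?_
  have hm : Measurable fun q : Weight k × Vec d k => app Bhat q.1 + q.2 :=
    ((measurable_app Bhat).comp measurable_fst).add measurable_snd
  have : IsMarkovKernel (A.map fun q : Weight k × Vec d k => app Bhat q.1 + q.2) :=
    Kernel.IsMarkovKernel.map A hm
  refine iInf₂_le_of_le (A.map fun q => app Bhat q.1 + q.2) this ?_
  refine iSup₂_le fun B hB' => le_iSup₂_of_le B
    ⟨hB', (isFrozenRep_iff hk hε σ hB' Bhat).2 ((isFrozenRep_iff hk hε σ hB Bhat).1 hBhat)⟩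
    (iSup₂_mono fun θ _ => ?_)
  refine lintegral_mono fun D => ?_
  rw [Kernel.map_apply _ hm]
  exact lintegral_map_le _ _

end

end HardLinear

theorem mainTheorem2 :
    ∃ c C : ℝ, 0 < c ∧ 0 < C ∧
      ∀ (d k n : ℕ) (ε σ : ℝ), 1 ≤ k → 2 * k ≤ d → 3 ≤ d → 1 ≤ n →
        0 < ε → ε < 1 → 0 < σ →
        ∀ Bstar ∈ HardLinear.trueReps d k,
          (∃ Bhat : HardLinear.Rep d k, HardLinear.IsFrozenRep ε σ Bstar Bhat) ∧
          ∀ Bhat : HardLinear.Rep d k, HardLinear.IsFrozenRep ε σ Bstar Bhat →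
            ENNReal.ofReal (c * min 1 (σ ^ 2 * (d : ℝ) / (n : ℝ)))
                ≤ HardLinear.frozenMinimaxRisk ε σ n Bhat ∧
            HardLinear.frozenMinimaxRisk ε σ n Bhat = HardLinear.targetMinimaxRisk d k ε σ n ∧
            HardLinear.targetMinimaxRisk d k ε σ n
                ≤ ENNReal.ofReal (C * (1 + σ ^ 2) * (d : ℝ) / (n : ℝ)) := by
  refine ⟨3 / 128, 4 * HardLinear.gaussianFourthMoment + 2, by norm_num,
    by linarith [HardLinear.gaussianFourthMoment_nonneg], ?_⟩
  intro d k n ε σ hk hkd hd hn hε _ hσ Bstar hB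
  refine ⟨⟨HardLinear.lastRep d k, (HardLinear.isFrozenRep_iff hk hε σ hB _).2
    (HardLinear.residualEnergy_lastRep_self ε)⟩, fun Bhat hBhat => ?_⟩
  have heq : HardLinear.frozenMinimaxRisk ε σ n Bhat = HardLinear.targetMinimaxRisk d k ε σ n :=
    le_antisymm (HardLinear.frozenMinimaxRisk_le_targetMinimaxRisk ε σ n Bhat)
      (HardLinear.targetMinimaxRisk_le_frozenMinimaxRisk hk hε σ n hB hBhat)
  refine ⟨?_, heq, ?_⟩
  · rw [heq]
    exact HardLinear.targetMinimaxRisk_lower_bound hk hkd hd hn hε hσ hB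
  · exact HardLinear.targetMinimaxRisk_upper_bound (by omega) hε hn σ
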